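/- **Setting.** Let $I=\{0=t_0<t_1<\dots<t_N=T\}$ and let $\mathcal K\subset\mathbb R^d$ be compact. $\mathcal{FP}_I(\mathcal K)$ denotes the collection of filtered processes $\mathbb X=(\Omega,\mathcal F,(\mathcal F_t)_{t\in I},\mathbb P,X)$, where $X=(X_t)_{t\in I}$ is an adapted process with values in $\mathcal K$ on a filtered probability space. The prediction process of $\mathbb X$ is the $\mathcal P((\mathbb R^d)^I)$-valued process $\hat X^1_t=\mathbb P[X\in\cdot\mid\mathcal F_t]$, $t\in I$ (regular conditional laws). All spaces $\mathcal P(\cdot)$ of Borel probability measures carry the weak topology. For a real Hilbert space $H$ let $\tilde H=\{(h_n)_{n\ge0}: h_n\in H^{\hat\otimes n},\ \sum_n\|h_n\|^2<\infty\}$ with $\|h\|_{\tilde H}^2=\sum_n\|h_n\|^2$, where $H^{\hat\otimes n}$ is the Hilbert tensor power, and let $\exp_\otimes(h)=\sum_n h^{\otimes n}/n!\in\tilde H$. The time-augmented signature of $x=(x_t)_{t\in I}\in H^I$ is $$S_H(x)=\prod_{i=0}^N\exp_\otimes\big(t_i-t_{i-1},\,x_{t_i}-x_{t_{i-1}}\big)\in\widetilde{\mathbb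 R\oplus H},\qquad t_{-1}:=0,\ x_{t_{-1}}:=0.$$ Put $\mathcal H^1=\widetilde{\mathbb R\oplus\mathbb R^d}$, $S=S_{\mathbb R^d}$, $\mathcal H^2=\widetilde{\mathbb R\oplus\mathcal H^1}$, and $S^2(\mu)=S_{\mathcal H^1}\big(t\mapsto\int S(x)\,\mu_t(dx)\big)\in\mathcal H^2$ for a path $\mu=(\mu_t)_{t\in I}$ of probability measures on $\mathcal K^I$. Expectations of $S$ and $S^2$ are Bochner integrals. Let $\hat\tau_0$ be the topology on $\mathcal{FP}_I(\mathcal K)$ induced by $\mathbb X\mapsto\mathcal L(X)\in\mathcal P((\mathbb R^d)^I)$ (weak convergence of laws), and $\hat\tau_1$ the one induced by $\mathbb X\mapsto\mathcal L(\hat X^1)\in\mathcal P(\mathcal P((\mathbb R^d)^I)^I)$ (Aldous' extended weak convergence). **Theorem.** 1. The rank 1 signature MMD $\mathcal D^1_{\mathcal S}(\mathbb X,\mathbb Y)=\|\mathbb E_{\mathbb P}[S(X)]-\mathbb E_{\mathbb Q}[S(Y)]\|_{\mathcal H^1}$ metrizes $\hat\tau_0$ on $\mathcal{FP}_I(\mathcal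 K)$: it is a pseudometric, the topology it generates is $\hat\tau_0$, it vanishes exactly when $\mathcal L(X)=\mathcal L(Y)$, and $\mathcal L(X^n)\to\mathcal L(X)$ weakly if and only if $\mathcal D^1_{\mathcal S}(\mathbb X^n,\mathbb X)\to0$. 2. The rank 2 signature MMD $\mathcal D^2_{\mathcal S}(\mathbb X,\mathbb Y)=\|\mathbb E_{\mathbb P}[S^2(\hat X^1)]-\mathbb E_{\mathbb Q}[S^2(\hat Y^1)]\|_{\mathcal H^2}$ metrizes $\hat\tau_1$ on $\mathcal{FP}_I(\mathcal K)$: it is a pseudometric, the topology it generates is $\hat\tau_1$, it vanishes exactly when $\mathcal L(\hat X^1)=\mathcal L(\hat Y^1)$, and $\mathcal L(\hat X^{n,1})\to\mathcal L(\hat X^1)$ weakly if and only if $\mathcal D^2_{\mathcal S}(\mathbb X^n,\mathbb X)\to0$. -/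

import Mathlib

open MeasureTheory ProbabilityTheory Filter Topology
open scoped ENNReal NNReal Nat

universe u

namespace SigMMD

noncomputable section

/-! ### Tensor series over an orthonormal basis

For a real Hilbert space with orthonormal basis `(e_i)_{i ∈ ι}`, the completed tensor power of
order `n` has the orthonormal basis `e_{i₁} ⊗ ⋯ ⊗ e_{iₙ}`, indexed by the words `[i₁, …, iₙ]`.
Tensor series are written in these coordinates, as functions on words. -/

/-- Coefficients of a tensor series with respect to the basis `e_{i₁} ⊗ ⋯ ⊗ e_{iₙ}`. -/
abbrev TensorSeries (ι : Type*) : Type _ := List ι → ℝ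

/-- The Hilbert space `ℓ²(ι)` with orthonormal basis indexed by `ι`. -/
abbrev L2 (ι : Type*) : Type _ := lp (fun _ : ι => ℝ) 2

/-- The Hilbert space `H̃` of square summable tensor series over `H = ℓ²(ι)`: the Hilbert sum over
`n` of the completed tensor powers of order `n` of `H`. -/
abbrev TensorL2 (ι : Type*) : Type _ := L2 (List ι)

/-- The tensor product of two tensor series:
`(a ⊗ b)_n = ∑_{k ≤ n} a_k ⊗ b_{n-k}` in coordinates. -/
def tmul {ι : Type*} (a b : TensorSeries ι) : TensorSeries ι := fun w =>
  ∑ k ∈ Finset.range (w.length + 1), a (w.take k) * b (w.drop k)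

/-- The unit `1` of the tensor product. -/
def tone {ι : Type*} : TensorSeries ι
  | [] => 1
  | _ :: _ => 0

/-- The tensor exponential `∑_n h^{⊗ n} / n!`; the coordinate of `h^{⊗ n}` at `[i₁, …, iₙ]` is
`h_{i₁} ⋯ h_{iₙ}`. -/
def texp {ι : Type*} (h : ι → ℝ) : TensorSeries ι := fun w => (w.map h).prod / (w.length ! : ℝ)

/-- The vector `(s, h) ∈ ℝ ⊕ H`, with the coordinate `none` for the time direction. -/
def augment {ι : Type*} (s : ℝ) (h : ι → ℝ) : Option ι → ℝ
  | none => s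
  | some i => h i

/-- The increment `z_i - z_{i-1}` of a discrete path, with the convention `z_{-1} = 0`. -/
def increment {E : Type*} [AddGroup E] {N : ℕ} (z : Fin (N + 1) → E) (i : Fin (N + 1)) : E :=
  Fin.cases (z 0) (fun j : Fin N => z j.succ - z j.castSucc) i

/-- The series `∏_{i=0}^N exp (t_i - t_{i-1}, x_i - x_{i-1})`, factors in increasing order of
`i`. -/
def sigSeries {ι : Type*} {N : ℕ} (t : Fin (N + 1) → ℝ) (x : Fin (N + 1) → L2 ι) :
    TensorSeries (Option ι) :=
  (List.ofFn fun i : Fin (N + 1) =>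
    texp (augment (increment t i) (increment x i : L2 ι))).foldr tmul tone

/-! Square summability of `sigSeries`. -/

/-- The tensors of order `n` of a series have squared norm at most `M ^ n / n !`. -/
def LevelBound {ι : Type*} (a : TensorSeries ι) (M : ℝ) : Prop :=
  ∀ (n : ℕ) (s : Finset (List ι)), (∀ w ∈ s, w.length = n) → ∑ w ∈ s, a w ^ 2 ≤ M ^ n / (n ! : ℝ)

lemma sum_take_drop_le {ι : Type*} (f g : List ι → ℝ) (hf : ∀ w, 0 ≤ f w) (hg : ∀ w, 0 ≤ g w)
    (n k : ℕ) (hk : k ≤ n) (A B : ℝ) (hA : 0 ≤ A)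
    (hfA : ∀ s : Finset (List ι), (∀ w ∈ s, w.length = k) → ∑ w ∈ s, f w ≤ A)
    (hgB : ∀ s : Finset (List ι), (∀ w ∈ s, w.length = n - k) → ∑ w ∈ s, g w ≤ B)
    (s : Finset (List ι)) (hs : ∀ w ∈ s, w.length = n) :
    ∑ w ∈ s, f (w.take k) * g (w.drop k) ≤ A * B := by
  classical
  let ψ : List ι → List ι × List ι := fun w => (w.take k, w.drop k)
  have hinj : Set.InjOn ψ s := by
    intro w _ w' _ h
    have h1 : w.take k = w'.take k := congrArg Prod.fst h
    have h2 : w.drop k = w'.drop k := congrArg Prod.snd h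
    rw [← List.take_append_drop k w, ← List.take_append_drop k w', h1, h2]
  calc ∑ w ∈ s, f (w.take k) * g (w.drop k)
      = ∑ p ∈ s.image ψ, f p.1 * g p.2 := by rw [Finset.sum_image hinj]
    _ ≤ ∑ p ∈ (s.image (List.take k)) ×ˢ (s.image (List.drop k)), f p.1 * g p.2 := by
        refine Finset.sum_le_sum_of_subset_of_nonneg ?_ fun p _ _ => mul_nonneg (hf _) (hg _)
        intro p hp
        obtain ⟨w, hw, rfl⟩ := Finset.mem_image.1 hp
        exact Finset.mem_product.2
          ⟨Finset.mem_image_of_mem _ hw, Finset.mem_image_of_mem _ hw⟩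
    _ = (∑ p ∈ s.image (List.take k), f p) * ∑ q ∈ s.image (List.drop k), g q := by
        rw [Finset.sum_mul_sum, Finset.sum_product]
    _ ≤ A * B := by
        refine mul_le_mul (hfA _ ?_) (hgB _ ?_) (Finset.sum_nonneg fun _ _ => hg _) hA
        · intro v hv
          obtain ⟨w, hw, rfl⟩ := Finset.mem_image.1 hv
          simp [hs w hw, hk]
        · intro v hv
          obtain ⟨w, hw, rfl⟩ := Finset.mem_image.1 hv
          simp [hs w hw]

lemma LevelBound.tmul {ι : Type*} {a b : TensorSeries ι} {M L : ℝ} (hM : 0 ≤ M) (hL : 0 ≤ L)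
    (ha : LevelBound a M) (hb : LevelBound b L) : LevelBound (tmul a b) (2 * (M + L)) := by
  intro n s hs
  have hpt : ∀ w ∈ s, (SigMMD.tmul a b w) ^ 2 ≤
      (n + 1 : ℝ) * ∑ k ∈ Finset.range (n + 1), a (w.take k) ^ 2 * b (w.drop k) ^ 2 := by
    intro w hw
    have h := sq_sum_le_card_mul_sum_sq (s := Finset.range (n + 1))
      (f := fun k => a (w.take k) * b (w.drop k))
    simp only [Finset.card_range, Nat.cast_add, Nat.cast_one, mul_pow] at h
    simpa [SigMMD.tmul, hs w hw] using h
  have h2 : ((n : ℝ) + 1) ≤ 2 ^ n := by exact_mod_cast Nat.lt_two_pow_self (n := n)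
  have hbin : ∑ k ∈ Finset.range (n + 1), (M ^ k / (k ! : ℝ)) * (L ^ (n - k) / ((n - k) ! : ℝ))
      = (M + L) ^ n / (n ! : ℝ) := by
    rw [add_pow, Finset.sum_div]
    refine Finset.sum_congr rfl fun k hk => ?_
    have hk' : k ≤ n := Nat.lt_succ_iff.1 (Finset.mem_range.1 hk)
    rw [Nat.cast_choose ℝ hk']
    have := Nat.factorial_ne_zero n
    have := Nat.factorial_ne_zero k
    have := Nat.factorial_ne_zero (n - k)
    field_simp
  calc ∑ w ∈ s, (SigMMD.tmul a b w) ^ 2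
      ≤ ∑ w ∈ s, (n + 1 : ℝ) *
          ∑ k ∈ Finset.range (n + 1), a (w.take k) ^ 2 * b (w.drop k) ^ 2 :=
        Finset.sum_le_sum hpt
    _ = (n + 1 : ℝ) * ∑ k ∈ Finset.range (n + 1), ∑ w ∈ s,
          a (w.take k) ^ 2 * b (w.drop k) ^ 2 := by
        rw [← Finset.mul_sum, Finset.sum_comm]
    _ ≤ (n + 1 : ℝ) * ∑ k ∈ Finset.range (n + 1),
          (M ^ k / (k ! : ℝ)) * (L ^ (n - k) / ((n - k) ! : ℝ)) := by
        refine mul_le_mul_of_nonneg_left (Finset.sum_le_sum fun k hk => ?_) (by positivity)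
        exact sum_take_drop_le (fun w => a w ^ 2) (fun w => b w ^ 2) (fun _ => sq_nonneg _)
          (fun _ => sq_nonneg _) n k (Nat.lt_succ_iff.1 (Finset.mem_range.1 hk)) _ _
          (by positivity) (ha k) (hb (n - k)) s hs
    _ = (n + 1 : ℝ) * ((M + L) ^ n / (n ! : ℝ)) := by rw [hbin]
    _ ≤ 2 ^ n * ((M + L) ^ n / (n ! : ℝ)) :=
        mul_le_mul_of_nonneg_right h2 (by positivity)
    _ = (2 * (M + L)) ^ n / (n ! : ℝ) := by rw [mul_pow]; ring

lemma levelBound_tone {ι : Type*} : LevelBound (tone : TensorSeries ι) 0 := by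
  intro n s hs
  cases n with
  | zero =>
    have : s ⊆ {[]} := fun w hw => by simpa using hs w hw
    refine (Finset.sum_le_sum_of_subset_of_nonneg this fun _ _ _ => sq_nonneg _).trans ?_
    simp [tone]
  | succ n =>
    refine le_of_eq ?_
    rw [zero_pow n.succ_ne_zero, zero_div]
    refine Finset.sum_eq_zero fun w hw => ?_
    cases w with
    | nil => simpa using hs _ hw
    | cons i w => simp [tone]

lemma levelBound_texp {ι : Type*} {h : ι → ℝ} (hh : Summable fun i => h i ^ 2) :
    LevelBound (texp h) (∑' i, h i ^ 2) := by
  classical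
  have hH : 0 ≤ ∑' i, h i ^ 2 := tsum_nonneg fun _ => sq_nonneg _
  have key : ∀ (n : ℕ) (s : Finset (List ι)), (∀ w ∈ s, w.length = n) →
      ∑ w ∈ s, (w.map h).prod ^ 2 ≤ (∑' i, h i ^ 2) ^ n := by
    intro n
    induction n with
    | zero =>
      intro s hs
      have : s ⊆ {[]} := fun w hw => by simpa using hs w hw
      refine (Finset.sum_le_sum_of_subset_of_nonneg this fun _ _ _ => sq_nonneg _).trans ?_
      simp
    | succ n ih =>
      intro s hs
      have h1 : ∀ s : Finset (List ι), (∀ w ∈ s, w.length = 1) →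
          ∑ w ∈ s, (w.map h).prod ^ 2 ≤ ∑' i, h i ^ 2 := by
        intro s hs
        have hsub : s ⊆ (s.biUnion List.toFinset).image (fun i => [i]) := by
          intro w hw
          obtain ⟨i, rfl⟩ := List.length_eq_one_iff.1 (hs w hw)
          exact Finset.mem_image.2 ⟨i, Finset.mem_biUnion.2 ⟨[i], hw, by simp⟩, rfl⟩
        refine (Finset.sum_le_sum_of_subset_of_nonneg hsub fun _ _ _ => sq_nonneg _).trans ?_
        rw [Finset.sum_image (fun i _ j _ hij => by simpa using hij)]
        simpa using hh.sum_le_tsum _ fun _ _ => sq_nonneg _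
      have := sum_take_drop_le (fun w => (w.map h).prod ^ 2) (fun w => (w.map h).prod ^ 2)
        (fun _ => sq_nonneg _) (fun _ => sq_nonneg _) (n + 1) 1 (by omega) _ _ hH h1
        (by simpa using ih) s hs
      rw [pow_succ']
      refine le_trans (le_of_eq (Finset.sum_congr rfl fun w _ => ?_)) this
      rw [← mul_pow, ← List.prod_append, ← List.map_append, List.take_append_drop]
  intro n s hs
  have hn : (1 : ℝ) ≤ (n ! : ℝ) := by exact_mod_cast Nat.factorial_pos n
  calc ∑ w ∈ s, texp h w ^ 2 = (∑ w ∈ s, (w.map h).prod ^ 2) / (n ! : ℝ) ^ 2 := by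
        rw [Finset.sum_div]
        exact Finset.sum_congr rfl fun w hw => by rw [texp, hs w hw, div_pow]
    _ ≤ (∑' i, h i ^ 2) ^ n / (n ! : ℝ) ^ 2 :=
        div_le_div_of_nonneg_right (key n s hs) (by positivity)
    _ ≤ (∑' i, h i ^ 2) ^ n / (n ! : ℝ) :=
        div_le_div_of_nonneg_left (by positivity) (by positivity) (le_self_pow₀ hn two_ne_zero)

lemma LevelBound.memℓp {ι : Type*} {a : TensorSeries ι} {M : ℝ} (hM : 0 ≤ M)
    (ha : LevelBound a M) : Memℓp a 2 := by
  classical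
  refine memℓp_gen ?_
  simp only [ENNReal.toReal_ofNat, Real.rpow_ofNat, Real.norm_eq_abs, sq_abs]
  refine summable_of_sum_le (c := Real.exp M) (fun _ => sq_nonneg _) fun s => ?_
  calc ∑ w ∈ s, a w ^ 2
      = ∑ n ∈ s.image List.length, ∑ w ∈ s with w.length = n, a w ^ 2 :=
        (Finset.sum_fiberwise_of_maps_to (fun w hw => Finset.mem_image_of_mem _ hw) _).symm
    _ ≤ ∑ n ∈ s.image List.length, M ^ n / (n ! : ℝ) :=
        Finset.sum_le_sum fun n _ => ha n _ fun w hw => (Finset.mem_filter.1 hw).2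
    _ ≤ ∑' n : ℕ, M ^ n / (n ! : ℝ) :=
        (Real.summable_pow_div_factorial M).sum_le_tsum _ fun _ _ => by positivity
    _ = Real.exp M := by
        rw [Real.exp_eq_exp_ℝ, NormedSpace.exp_eq_tsum_div]

lemma summable_augment {ι : Type*} (s : ℝ) (h : L2 ι) :
    Summable fun i => augment s h i ^ 2 := by
  have hs : Summable fun i => (h i) ^ 2 := by
    have := (lp.memℓp h).summable (by simp)
    simpa using this
  classical
  refine summable_of_sum_le (c := s ^ 2 + ∑' i, h i ^ 2) (fun _ => sq_nonneg _) fun v => ?_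
  refine (Finset.sum_le_sum_of_subset_of_nonneg (t := Finset.insertNone (Finset.eraseNone v))
    ?_ fun _ _ _ => sq_nonneg _).trans ?_
  · rw [Finset.insertNone_eraseNone]
    exact Finset.subset_insert _ _
  · rw [Finset.sum_insertNone]
    simpa [augment] using hs.sum_le_tsum _ fun _ _ => sq_nonneg _

lemma memℓp_sigSeries {ι : Type*} {N : ℕ} (t : Fin (N + 1) → ℝ) (x : Fin (N + 1) → L2 ι) :
    Memℓp (sigSeries t x) 2 := by
  have : ∀ l : List (TensorSeries (Option ι)), (∀ a ∈ l, ∃ M, 0 ≤ M ∧ LevelBound a M) →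
      ∃ M, 0 ≤ M ∧ LevelBound (l.foldr tmul tone) M := by
    intro l
    induction l with
    | nil => exact fun _ => ⟨0, le_rfl, levelBound_tone⟩
    | cons a l ih =>
      intro hl
      obtain ⟨M, hM, hb⟩ := hl a (by simp)
      obtain ⟨L, hL, hc⟩ := ih fun b hb => hl b (by simp [hb])
      exact ⟨2 * (M + L), by positivity, hb.tmul hM hL hc⟩
  obtain ⟨M, hM, hb⟩ := this (List.ofFn fun i : Fin (N + 1) =>
      texp (augment (increment t i) (increment x i : L2 ι))) (by
    intro a ha
    obtain ⟨i, rfl⟩ := (List.mem_ofFn' _ _).1 ha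
    exact ⟨_, tsum_nonneg fun _ => sq_nonneg _, levelBound_texp (summable_augment _ _)⟩)
  exact hb.memℓp hM

/-! ### Signatures of rank one and two -/

/-- The time-augmented signature `S_H` of a discrete path in `H = ℓ²(ι)` observed at the times
`t_0 < ⋯ < t_N`, an element of the Hilbert space of square summable tensor series over `ℝ ⊕ H`. -/
def signature {ι : Type*} {N : ℕ} (t : Fin (N + 1) → ℝ) (x : Fin (N + 1) → L2 ι) :
    TensorL2 (Option ι) :=
  ⟨sigSeries t x, memℓp_sigSeries t x⟩

/-- `ℝ^d`. -/
abbrev State (d : ℕ) : Type := EuclideanSpace ℝ (Fin d)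

/-- The path space `(ℝ^d)^I` for `I = {t_0 < ⋯ < t_N}`. -/
abbrev PathSpace (N d : ℕ) : Type := Fin (N + 1) → State d

/-- The space `𝓗¹` of square summable tensor series over `ℝ ⊕ ℝ^d`. -/
abbrev H1 (d : ℕ) : Type := TensorL2 (Option (Fin d))

/-- The space `𝓗²` of square summable tensor series over `ℝ ⊕ 𝓗¹`. -/
abbrev H2 (d : ℕ) : Type := TensorL2 (Option (List (Option (Fin d))))

/-- `ℝ^d` as the space `ℓ²` over its coordinates. -/
def toL2 {d : ℕ} (x : State d) : L2 (Fin d) := ⟨fun i => x i, Memℓp.all _⟩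

/-- The time-augmented signature `S : (ℝ^d)^I → 𝓗¹`. -/
def S1 {N d : ℕ} (t : Fin (N + 1) → ℝ) (x : PathSpace N d) : H1 d :=
  signature t fun i => toL2 (x i)

/-- The rank two signature `S²` of a path of probability measures on path space: the signature of
the `𝓗¹`-valued path of expected signatures. -/
def S2 {N d : ℕ} (t : Fin (N + 1) → ℝ) (μ : Fin (N + 1) → ProbabilityMeasure (PathSpace N d)) : H2 d :=
  signature t fun i => ∫ x, S1 t x ∂(μ i : Measure (PathSpace N d))

/-! ### Filtered processes and prediction processes -/

/-- A filtered process indexed by `I = {t_0 < ⋯ < t_N}` with values in `K ⊆ ℝ^d`. -/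
structure FilteredProcess (N d : ℕ) (K : Set (State d)) : Type (u + 1) where
  Ω : Type u
  mΩ : MeasurableSpace Ω
  filtration : Filtration (Fin (N + 1)) mΩ
  P : Measure Ω
  isProbabilityMeasure : IsProbabilityMeasure P
  X : Fin (N + 1) → Ω → State d
  adapted : Adapted filtration X
  mem : ∀ i ω, X i ω ∈ K

attribute [instance] FilteredProcess.mΩ FilteredProcess.isProbabilityMeasure

/-- Integrals of the continuous approximations of the complements of finite unions of basic open
sets. -/
def testIntegrals (E : Type*) [TopologicalSpace E] [TopologicalSpace.PseudoMetrizableSpace E]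
    [SecondCountableTopology E] [MeasurableSpace E] [OpensMeasurableSpace E]
    (μ : ProbabilityMeasure E) (p : Finset (TopologicalSpace.countableBasis E) × ℕ) : ℝ≥0∞ :=
  ∫⁻ x, ((isOpen_biUnion (s := (p.1 : Set (TopologicalSpace.countableBasis E)))
    (f := fun U => (U : Set E)) fun U _ =>
      TopologicalSpace.isOpen_of_mem_countableBasis U.2).isClosed_compl.apprSeq p.2 x : ℝ≥0∞)
      ∂(μ : Measure E)

lemma isInducing_testIntegrals (E : Type*) [TopologicalSpace E]
    [TopologicalSpace.PseudoMetrizableSpace E]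
    [SecondCountableTopology E] [MeasurableSpace E] [OpensMeasurableSpace E] :
    IsInducing (testIntegrals E) := by
  classical
  refine isInducing_iff_nhds.2 fun μ => le_antisymm ?_ ?_
  · refine tendsto_iff_comap.1 (tendsto_pi_nhds.2 fun p => ?_)
    exact (ProbabilityMeasure.tendsto_iff_forall_lintegral_tendsto.1 tendsto_id) _
  · have : Tendsto id (comap (testIntegrals E) (𝓝 (testIntegrals E μ))) (𝓝 μ) := by
      refine tendsto_of_forall_isOpen_le_liminf' fun G hG => ?_
      refine le_of_forall_lt fun r hr => ?_
      lift r to ℝ≥0 using hr.ne_top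
      obtain ⟨r', hr1, hr2⟩ := ENNReal.lt_iff_exists_nnreal_btwn.1 hr
      have hr2' : r' < μ G := by
        rw [← ENNReal.coe_lt_coe]; simpa using hr2
      obtain ⟨T, hT, hrT, hTG⟩ := μ.exists_lt_measure_biUnion_of_isOpen
        (S := TopologicalSpace.countableBasis E) (fun u hu x hx => by
          obtain ⟨v, hv, hxv, hvu⟩ :=
            (TopologicalSpace.isBasis_countableBasis E).exists_subset_of_mem_open hx hu
          exact ⟨v, hv, (TopologicalSpace.isOpen_of_mem_countableBasis hv).mem_nhds hxv, hvu⟩)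
        hG hr2'
      let T' : Finset (TopologicalSpace.countableBasis E) := T.subtype _
      let V : Set E := ⋃ U ∈ (T' : Set (TopologicalSpace.countableBasis E)), (U : Set E)
      have hVT : V = ⋃ t ∈ T, t := by
        ext x
        simp only [V, T', Set.mem_iUnion, Finset.mem_coe, Finset.mem_subtype]
        constructor
        · rintro ⟨U, hU, hx⟩
          exact ⟨U, hU, hx⟩
        · rintro ⟨U, hU, hx⟩
          exact ⟨⟨U, hT U hU⟩, hU, hx⟩
      have hVo : IsOpen V := isOpen_biUnion fun U _ =>
        TopologicalSpace.isOpen_of_mem_countableBasis U.2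
      have hrV : (r' : ℝ≥0∞) < (μ : Measure E) V := by
        rw [hVT, ← ProbabilityMeasure.ennreal_coeFn_eq_coeFn_toMeasure]
        exact_mod_cast hrT
      have hcompl : ∀ ν : ProbabilityMeasure E, (ν : Measure E) Vᶜ = 1 - (ν : Measure E) V :=
        fun ν => prob_compl_eq_one_sub hVo.measurableSet
      have hr'1 : (r' : ℝ≥0∞) < 1 := hrV.trans_le prob_le_one
      have hlt : (μ : Measure E) Vᶜ < 1 - r' := by
        rw [hcompl]
        refine not_le.1 fun h => ?_
        exact not_le.2 hrV ((ENNReal.sub_le_sub_iff_left prob_le_one ENNReal.one_ne_top).1 h)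
      obtain ⟨n, hn⟩ := ((HasOuterApproxClosed.tendsto_lintegral_apprSeq hVo.isClosed_compl
        (μ : Measure E)).eventually_lt_const hlt).exists
      have hev : ∀ᶠ ν in comap (testIntegrals E) (𝓝 (testIntegrals E μ)),
          testIntegrals E ν (T', n) < 1 - r' :=
        (((continuous_apply (T', n)).tendsto (testIntegrals E μ)).comp
          tendsto_comap).eventually_lt_const hn
      refine lt_of_lt_of_le hr1 (le_liminf_of_le (by isBoundedDefault) ?_)
      filter_upwards [hev] with ν hν
      have h1 : (ν : Measure E) Vᶜ < 1 - r' :=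
        (HasOuterApproxClosed.measure_le_lintegral hVo.isClosed_compl _ n).trans_lt hν
      rw [hcompl] at h1
      have h2 : (r' : ℝ≥0∞) < (ν : Measure E) V := by
        by_contra hle
        exact absurd h1 (not_lt.2 (tsub_le_tsub_left (not_lt.1 hle) _))
      exact h2.le.trans (measure_mono (hVT ▸ hTG))
    exact tendsto_id'.1 this

lemma measurable_testIntegrals (E : Type*) [TopologicalSpace E]
    [TopologicalSpace.PseudoMetrizableSpace E]
    [SecondCountableTopology E] [MeasurableSpace E] [OpensMeasurableSpace E] :
    Measurable (testIntegrals E) := by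
  refine measurable_pi_iff.2 fun p => ?_
  exact (Measure.measurable_lintegral
    (BoundedContinuousFunction.continuous _).measurable.coe_nnreal_ennreal).comp
      measurable_subtype_coe

instance instSecondCountableProbabilityMeasure (E : Type*) [TopologicalSpace E]
    [TopologicalSpace.PseudoMetrizableSpace E]
    [SecondCountableTopology E] [MeasurableSpace E] [OpensMeasurableSpace E] :
    SecondCountableTopology (ProbabilityMeasure E) :=
  (isInducing_testIntegrals E).secondCountableTopology

/-- Weakly open sets of probability measures are measurable, so that a law on the space of
probability measures is a Borel law for the weak topology. -/
instance instOpensMeasurableProbabilityMeasure (E : Type*) [TopologicalSpace E]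
    [TopologicalSpace.PseudoMetrizableSpace E]
    [SecondCountableTopology E] [MeasurableSpace E] [OpensMeasurableSpace E] :
    OpensMeasurableSpace (ProbabilityMeasure E) where
  borel_le := by
    refine MeasurableSpace.generateFrom_le fun s hs => ?_
    obtain ⟨o, ho, rfl⟩ := (isInducing_testIntegrals E).isOpen_iff.1 hs
    exact measurable_testIntegrals E ho.measurableSet

namespace FilteredProcess

variable {N d : ℕ} {K : Set (State d)}

/-- The trajectory of the process, as a random element of path space. -/
def path (𝕏 : FilteredProcess.{u} N d K) (ω : 𝕏.Ω) : PathSpace N d := fun i => 𝕏.X i ω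

lemma measurable_path (𝕏 : FilteredProcess.{u} N d K) : Measurable 𝕏.path :=
  measurable_pi_iff.2 fun i => (𝕏.adapted i).mono (𝕏.filtration.le i) le_rfl

/-- The prediction process `X̂_i = P[X ∈ · | 𝓕_i]`, as a regular conditional distribution of the
trajectory given the `σ`-algebra `𝓕_i`. -/
def prediction (𝕏 : FilteredProcess.{u} N d K) (ω : 𝕏.Ω) (i : Fin (N + 1)) :
    ProbabilityMeasure (PathSpace N d) :=
  letI κ := @condDistrib 𝕏.Ω 𝕏.Ω (PathSpace N d) _ _ _ 𝕏.mΩ (𝕏.filtration i) 𝕏.path id 𝕏.P _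
  ⟨κ ω, by infer_instance⟩

/-- `X̂_i` is adapted. -/
lemma measurable_prediction_filtration (𝕏 : FilteredProcess.{u} N d K) (i : Fin (N + 1)) :
    Measurable[𝕏.filtration i] fun ω => 𝕏.prediction ω i :=
  Measurable.subtype_mk
    (@condDistrib 𝕏.Ω 𝕏.Ω (PathSpace N d) _ _ _ 𝕏.mΩ (𝕏.filtration i) 𝕏.path id 𝕏.P _).measurable

/-- `X̂_i` is a version of the conditional law of the trajectory given `𝓕_i`. -/
lemma prediction_ae_eq (𝕏 : FilteredProcess.{u} N d K) (i : Fin (N + 1)) {A : Set (PathSpace N d)}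
    (hA : MeasurableSet A) :
    (fun ω => (𝕏.prediction ω i : Measure (PathSpace N d)).real A) =ᵐ[𝕏.P]
      𝕏.P[(𝕏.path ⁻¹' A).indicator (fun _ => (1 : ℝ)) | 𝕏.filtration i] := by
  have h := @condDistrib_ae_eq_condExp 𝕏.Ω 𝕏.Ω (PathSpace N d) _ _ _ 𝕏.mΩ 𝕏.P _ id 𝕏.path
    (𝕏.filtration i) A (measurable_id'' (𝕏.filtration.le i)) 𝕏.measurable_path hA
  rw [MeasurableSpace.comap_id] at h
  exact h

lemma measurable_prediction (𝕏 : FilteredProcess.{u} N d K) : Measurable 𝕏.prediction :=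
  measurable_pi_iff.2 fun i =>
    (𝕏.measurable_prediction_filtration i).mono (𝕏.filtration.le i) le_rfl

/-- The law of the trajectory `X`. -/
def law0 (𝕏 : FilteredProcess.{u} N d K) : ProbabilityMeasure (PathSpace N d) :=
  ⟨𝕏.P.map 𝕏.path, Measure.isProbabilityMeasure_map 𝕏.measurable_path.aemeasurable⟩

/-- The law of the prediction process `X̂`. -/
def law1 (𝕏 : FilteredProcess.{u} N d K) :
    ProbabilityMeasure (Fin (N + 1) → ProbabilityMeasure (PathSpace N d)) :=
  ⟨𝕏.P.map 𝕏.prediction, Measure.isProbabilityMeasure_map 𝕏.measurable_prediction.aemeasurable⟩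

end FilteredProcess

/-! ### Adapted topologies and signature discrepancies -/

/-- The topology of weak convergence of the laws of the processes. -/
abbrev tau0 (N d : ℕ) (K : Set (State d)) : TopologicalSpace (FilteredProcess.{u} N d K) :=
  TopologicalSpace.induced FilteredProcess.law0 inferInstance

/-- The topology of extended weak convergence, i.e. of weak convergence of the laws of the
prediction processes. -/
abbrev tau1 (N d : ℕ) (K : Set (State d)) : TopologicalSpace (FilteredProcess.{u} N d K) :=
  TopologicalSpace.induced FilteredProcess.law1 inferInstance

/-- The rank one signature discrepancy `‖E[S(X)] - E[S(Y)]‖`. -/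
def D1 {N d : ℕ} {K : Set (State d)} (t : Fin (N + 1) → ℝ) (𝕏 𝕐 : FilteredProcess.{u} N d K) :
    ℝ :=
  ‖(∫ ω, S1 t (𝕏.path ω) ∂𝕏.P) - ∫ ω, S1 t (𝕐.path ω) ∂𝕐.P‖

/-- The rank two signature discrepancy `‖E[S²(X̂)] - E[S²(Ŷ)]‖`. -/
def D2 {N d : ℕ} {K : Set (State d)} (t : Fin (N + 1) → ℝ) (𝕏 𝕐 : FilteredProcess.{u} N d K) :
    ℝ :=
  ‖(∫ ω, S2 t (𝕏.prediction ω) ∂𝕏.P) - ∫ ω, S2 t (𝕐.prediction ω) ∂𝕐.P‖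

/-- `D` is a pseudometric whose balls generate the topology `τ`. -/
structure Metrizes {α : Type*} (D : α → α → ℝ) (τ : TopologicalSpace α) : Prop where
  self : ∀ x, D x x = 0
  symm : ∀ x y, D x y = D y x
  triangle : ∀ x y z, D x z ≤ D x y + D y z
  isOpen_iff : ∀ s : Set α, IsOpen[τ] s ↔ ∀ x ∈ s, ∃ ε > 0, ∀ y, D x y < ε → y ∈ s

end

end SigMMD

open SigMMD

namespace SigMMD

noncomputable section

/-! ### Shuffles -/

/-! Call a feature map from a compact space C into ℓ² algebraic (`IsAlgebraicFeature`) if its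
coordinates are continuous, dominated by one ℓ² vector, include the constant 1 and span an algebra,
and if it is injective. By Stone–Weierstrass this span is dense in the continuous functions, so μ ↦
∫ F dμ is injective on probability measures. Domination makes it weakly continuous, and the
probability measures on C are weakly compact, so it is a topological embedding
(`IsAlgebraicFeature.isEmbedding_meanEmbedding`).

Signatures are algebraic features (`isAlgebraicFeature_signature`). Products of tensor exponentials
are group-like, so a product of two coordinates is a sum of coordinates over shuffles. All
coordinates are dominated by those of the signature of a single path with large increments.
Injectivity uses the time component: the coordinates at words j 0⋯0, one space letter followed by
time letters, are up to factorials sums of divided differences of monomials at the times still to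
go, weighted by the increments. Polynomials vanishing at all smaller nodes isolate the increments
one at a time (`sigSeries_injective`).

The construction iterates: the expected signature is coordinatewise continuous, dominated and
injective on measures over paths in K, so S² is again an algebraic feature, now on a compact space
of paths of measures (`isAlgebraicFeature_S2In`). At either rank, law and expected feature are
images of one measure on the compact space under two embeddings, hence induce the same topology
(`metrizes_of_isEmbedding`). -/

/-- The sum of `f p q` over all splittings `w = p ++ q` of a word. -/
def splitSum {ι : Type*} (f : List ι → List ι → ℝ) (w : List ι) : ℝ :=
  ∑ k ∈ Finset.range (w.length + 1), f (w.take k) (w.drop k)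

lemma splitSum_nil {ι : Type*} (f : List ι → List ι → ℝ) : splitSum f [] = f [] [] := by
  simp [splitSum]

lemma splitSum_cons {ι : Type*} (f : List ι → List ι → ℝ) (i : ι) (w : List ι) :
    splitSum f (i :: w) = f [] (i :: w) + splitSum (fun p q => f (i :: p) q) w := by
  simp only [splitSum, List.length_cons]
  rw [Finset.sum_range_succ' _ (w.length + 1), add_comm]
  simp

lemma splitSum_add {ι : Type*} (f g : List ι → List ι → ℝ) (w : List ι) :
    splitSum (fun p q => f p q + g p q) w = splitSum f w + splitSum g w :=
  Finset.sum_add_distrib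

lemma splitSum_mul_left {ι : Type*} (c : ℝ) (f : List ι → List ι → ℝ) (w : List ι) :
    splitSum (fun p q => c * f p q) w = c * splitSum f w :=
  (Finset.mul_sum _ _ _).symm

lemma tmul_eq_splitSum {ι : Type*} (a b : TensorSeries ι) (w : List ι) :
    tmul a b w = splitSum (fun p q => a p * b q) w := rfl

lemma tmul_cons {ι : Type*} (a b : TensorSeries ι) (i : ι) (w : List ι) :
    tmul a b (i :: w) = a [] * b (i :: w) + tmul (fun v => a (i :: v)) b w :=
  splitSum_cons (fun p q => a p * b q) i w

/-- The sum of the coordinates of a series over all shuffles of two words. -/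
def shuffleSum {ι : Type*} : List ι → List ι → TensorSeries ι → ℝ
  | [], v, a => a v
  | i :: u, [], a => a (i :: u)
  | i :: u, j :: v, a =>
    shuffleSum u (j :: v) (fun w => a (i :: w)) + shuffleSum (i :: u) v (fun w => a (j :: w))
termination_by u v => u.length + v.length

lemma shuffleSum_nil_left {ι : Type*} (v : List ι) (a : TensorSeries ι) :
    shuffleSum [] v a = a v := by
  rw [shuffleSum]

lemma shuffleSum_nil_right {ι : Type*} (u : List ι) (a : TensorSeries ι) :
    shuffleSum u [] a = a u := by
  cases u <;> rw [shuffleSum]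

lemma shuffleSum_cons_cons {ι : Type*} (i j : ι) (u v : List ι) (a : TensorSeries ι) :
    shuffleSum (i :: u) (j :: v) a =
      shuffleSum u (j :: v) (fun w => a (i :: w)) +
        shuffleSum (i :: u) v (fun w => a (j :: w)) := by
  rw [shuffleSum]

/-- Induction on pairs of words along the recursion of the shuffle. -/
lemma shuffle_induction {ι : Type*} {p : List ι → List ι → Prop} (left : ∀ v, p [] v)
    (right : ∀ u, p u [])
    (step : ∀ i u j v, p u (j :: v) → p (i :: u) v → p (i :: u) (j :: v)) (u v : List ι) :
    p u v := by
  induction u generalizing v with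
  | nil => exact left v
  | cons i u ihu =>
    induction v with
    | nil => exact right _
    | cons j v ihv => exact step i u j v (ihu _) ihv

lemma shuffleSum_add {ι : Type*} (u v : List ι) (a b : TensorSeries ι) :
    shuffleSum u v (fun w => a w + b w) = shuffleSum u v a + shuffleSum u v b := by
  revert a b
  refine shuffle_induction (p := fun u v => ∀ a b : TensorSeries ι,
    shuffleSum u v (fun w => a w + b w) = shuffleSum u v a + shuffleSum u v b) ?_ ?_ ?_ u v
  · intro v a b; simp only [shuffleSum_nil_left]
  · intro u a b; simp only [shuffleSum_nil_right]
  · intro i u j v h1 h2 a b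
    simp only [shuffleSum_cons_cons, h1, h2]
    ring

lemma shuffleSum_mul_left {ι : Type*} (u v : List ι) (c : ℝ) (a : TensorSeries ι) :
    shuffleSum u v (fun w => c * a w) = c * shuffleSum u v a := by
  revert a
  refine shuffle_induction (p := fun u v => ∀ a : TensorSeries ι,
    shuffleSum u v (fun w => c * a w) = c * shuffleSum u v a) ?_ ?_ ?_ u v
  · intro v a; simp only [shuffleSum_nil_left]
  · intro u a; simp only [shuffleSum_nil_right]
  · intro i u j v h1 h2 a
    simp only [shuffleSum_cons_cons, h1, h2]
    ring

/-- A shuffle sum is a finite sum of coordinates. -/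
lemma exists_shuffleSum_eq {ι : Type*} (u v : List ι) :
    ∃ l : List (List ι), ∀ a : TensorSeries ι, shuffleSum u v a = (l.map a).sum := by
  refine shuffle_induction (p := fun u v => ∃ l : List (List ι), ∀ a : TensorSeries ι,
    shuffleSum u v a = (l.map a).sum) ?_ ?_ ?_ u v
  · intro v; exact ⟨[v], fun a => by simp [shuffleSum_nil_left]⟩
  · intro u; exact ⟨[u], fun a => by simp [shuffleSum_nil_right]⟩
  · rintro i u j v ⟨l, hl⟩ ⟨m, hm⟩
    refine ⟨l.map (i :: ·) ++ m.map (j :: ·), fun a => ?_⟩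
    rw [shuffleSum_cons_cons, hl, hm, List.map_append, List.sum_append, List.map_map,
      List.map_map]
    rfl

/-- Deconcatenation is multiplicative for the shuffle product. -/
lemma shuffleSum_tmul {ι : Type*} (u v : List ι) (a b : TensorSeries ι) :
    shuffleSum u v (tmul a b) = splitSum (fun p q => splitSum (fun r s =>
      shuffleSum p r a * shuffleSum q s b) v) u := by
  -- The series must stay general: removing the first letter i replaces `a` by its shift w ↦ a (i ::
  -- w).
  revert a
  refine shuffle_induction (p := fun u v => ∀ a : TensorSeries ι,
    shuffleSum u v (tmul a b) = splitSum (fun p q => splitSum (fun r s =>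
      shuffleSum p r a * shuffleSum q s b) v) u) ?_ ?_ ?_ u v
  · intro v a
    simp only [shuffleSum_nil_left, splitSum_nil, tmul_eq_splitSum]
  · intro u a
    simp only [shuffleSum_nil_right, splitSum_nil, tmul_eq_splitSum]
  · intro i u j v h1 h2 a
    simp only [shuffleSum_cons_cons, tmul_cons, shuffleSum_add, shuffleSum_mul_left, h1, h2,
      splitSum_cons, splitSum_add, shuffleSum_nil_left, shuffleSum_nil_right, add_mul]
    ring

/-- Group-like series: those whose coordinates multiply by the shuffle product. -/
def IsGroupLike {ι : Type*} (a : TensorSeries ι) : Prop :=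
  a [] = 1 ∧ ∀ u v, shuffleSum u v a = a u * a v

lemma IsGroupLike.tmul {ι : Type*} {a b : TensorSeries ι} (ha : IsGroupLike a)
    (hb : IsGroupLike b) : IsGroupLike (tmul a b) := by
  refine ⟨by simp [SigMMD.tmul, ha.1, hb.1], fun u v => ?_⟩
  rw [shuffleSum_tmul]
  simp only [ha.2, hb.2, tmul_eq_splitSum]
  rw [mul_comm, ← splitSum_mul_left]
  congr 1
  ext p q
  rw [mul_comm, ← splitSum_mul_left]
  congr 1
  ext r s
  ring

lemma isGroupLike_tone {ι : Type*} : IsGroupLike (tone : TensorSeries ι) := by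
  refine ⟨rfl, fun u v => ?_⟩
  cases u with
  | nil => simp [shuffleSum_nil_left, tone]
  | cons i u =>
    cases v with
    | nil => simp [shuffleSum_nil_right, tone]
    | cons j v =>
      have h0 : ∀ u v : List ι, shuffleSum u v (fun _ => 0) = 0 := fun u v => by
        simpa using shuffleSum_mul_left u v 0 fun _ => 0
      simp [shuffleSum_cons_cons, tone, h0]

/-- There are binomially many shuffles of two words, all of the same length and with the same
product of letters. The weight `c` is arbitrary because removing a letter shifts the length; for c n
= 1/n! the binomial coefficient cancels and `texp` is group-like. -/
lemma shuffleSum_prod {ι : Type*} (h : ι → ℝ) (u v : List ι) (c : ℕ → ℝ) :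
    shuffleSum u v (fun w => c w.length * (w.map h).prod) =
      ((u.length + v.length).choose u.length : ℝ) * c (u.length + v.length) *
        ((u.map h).prod * (v.map h).prod) := by
  revert c
  refine shuffle_induction (p := fun u v => ∀ c : ℕ → ℝ,
    shuffleSum u v (fun w => c w.length * (w.map h).prod) =
      ((u.length + v.length).choose u.length : ℝ) * c (u.length + v.length) *
        ((u.map h).prod * (v.map h).prod)) ?_ ?_ ?_ u v
  · intro v c; simp [shuffleSum_nil_left]
  · intro u c; simp [shuffleSum_nil_right]
  · intro i u j v h1 h2 c
    -- The removed letter is absorbed into a new weight for the shorter words.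
    have e1 := h1 fun n => h i * c (n + 1)
    have e2 := h2 fun n => h j * c (n + 1)
    have r1 : (fun w : List ι => h i * c (w.length + 1) * (w.map h).prod) =
        fun w => c (i :: w).length * ((i :: w).map h).prod := by
      ext w; simp; ring
    have r2 : (fun w : List ι => h j * c (w.length + 1) * (w.map h).prod) =
        fun w => c (j :: w).length * ((j :: w).map h).prod := by
      ext w; simp; ring
    rw [r1] at e1
    rw [r2] at e2
    rw [shuffleSum_cons_cons, e1, e2]
    simp only [List.length_cons, List.map_cons, List.prod_cons]
    have hp : (u.length + 1 + (v.length + 1)).choose (u.length + 1) =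
        (u.length + (v.length + 1)).choose u.length +
          (u.length + 1 + v.length).choose (u.length + 1) := by
      rw [show u.length + 1 + (v.length + 1) = (u.length + (v.length + 1)) + 1 by ring,
        Nat.choose_succ_succ, show u.length + (v.length + 1) = u.length + 1 + v.length by ring]
    rw [hp, show u.length + 1 + (v.length + 1) = u.length + (v.length + 1) + 1 by ring,
      show u.length + 1 + v.length + 1 = u.length + (v.length + 1) + 1 by ring]
    push_cast
    ring

lemma isGroupLike_texp {ι : Type*} (h : ι → ℝ) : IsGroupLike (texp h) := by
  refine ⟨by simp [texp], fun u v => ?_⟩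
  have e := shuffleSum_prod h u v fun n => ((n ! : ℕ) : ℝ)⁻¹
  have r : texp h = fun w => ((w.length ! : ℕ) : ℝ)⁻¹ * (w.map h).prod := by
    ext w; rw [texp, div_eq_inv_mul]
  rw [r, e, Nat.cast_add_choose]
  have := Nat.factorial_ne_zero u.length
  have := Nat.factorial_ne_zero v.length
  have := Nat.factorial_ne_zero (u.length + v.length)
  field_simp

/-! ### Products of tensor exponentials -/

/-- The product of the tensor exponentials of `h a` along a list of indices `a`. -/
def expProd {α κ : Type*} (h : α → κ → ℝ) (l : List α) : TensorSeries κ :=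
  (l.map fun a => texp (h a)).foldr tmul tone

lemma expProd_nil {α κ : Type*} (h : α → κ → ℝ) : expProd h [] = tone := rfl

lemma expProd_cons {α κ : Type*} (h : α → κ → ℝ) (a : α) (l : List α) :
    expProd h (a :: l) = tmul (texp (h a)) (expProd h l) := rfl

lemma sigSeries_eq_expProd {ι : Type*} {N : ℕ} (t : Fin (N + 1) → ℝ) (x : Fin (N + 1) → L2 ι) :
    sigSeries t x =
      expProd (fun i => augment (increment t i) (increment x i : L2 ι)) (List.finRange (N + 1)) := by
  rw [sigSeries, List.ofFn_eq_map, expProd]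

lemma isGroupLike_expProd {α κ : Type*} (h : α → κ → ℝ) (l : List α) :
    IsGroupLike (expProd h l) := by
  induction l with
  | nil => exact isGroupLike_tone
  | cons a l ih => exact (isGroupLike_texp _).tmul ih

lemma isGroupLike_sigSeries {ι : Type*} {N : ℕ} (t : Fin (N + 1) → ℝ) (x : Fin (N + 1) → L2 ι) :
    IsGroupLike (sigSeries t x) := by
  rw [sigSeries_eq_expProd]
  exact isGroupLike_expProd _ _

/-! ### The signature determines the path -/

lemma splitSum_replicate {ι : Type*} (f : List ι → List ι → ℝ) (i : ι) (n : ℕ) :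
    splitSum f (List.replicate n i) =
      ∑ k ∈ Finset.range (n + 1), f (List.replicate k i) (List.replicate (n - k) i) := by
  rw [splitSum, List.length_replicate]
  refine Finset.sum_congr rfl fun k hk => ?_
  rw [List.take_replicate, List.drop_replicate,
    min_eq_left (Nat.lt_succ_iff.1 (Finset.mem_range.1 hk))]

lemma sum_pow_div_factorial (a b : ℝ) (n : ℕ) :
    ∑ k ∈ Finset.range (n + 1), a ^ k / (k ! : ℝ) * (b ^ (n - k) / ((n - k) ! : ℝ)) =
      (a + b) ^ n / (n ! : ℝ) := by
  rw [add_pow, Finset.sum_div]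
  refine Finset.sum_congr rfl fun k hk => ?_
  rw [Nat.cast_choose ℝ (Nat.lt_succ_iff.1 (Finset.mem_range.1 hk))]
  have := Nat.factorial_ne_zero n
  have := Nat.factorial_ne_zero k
  have := Nat.factorial_ne_zero (n - k)
  field_simp

/-- Along powers of a single letter the exponentials commute, so their exponents add. -/
lemma expProd_replicate {α κ : Type*} (h : α → κ → ℝ) (l : List α) (i : κ) (n : ℕ) :
    expProd h l (List.replicate n i) = (l.map fun a => h a i).sum ^ n / (n ! : ℝ) := by
  induction l generalizing n with
  | nil => cases n <;> simp [expProd_nil, tone, List.replicate_succ]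
  | cons a l ih =>
    rw [expProd_cons, tmul_eq_splitSum, splitSum_replicate]
    simp only [ih, texp, List.map_replicate, List.prod_replicate, List.length_replicate,
      List.map_cons, List.sum_cons]
    exact sum_pow_div_factorial _ _ _

/-- Either the first factor contributes the empty word, or it supplies `j` and `k` further letters
`i`, a word of length k + 1, and the remaining factors supply the rest. -/
lemma expProd_cons_replicate {α κ : Type*} (h : α → κ → ℝ) (a : α) (l : List α) (i j : κ)
    (n : ℕ) :
    expProd h (a :: l) (j :: List.replicate n i) = expProd h l (j :: List.replicate n i) +
      h a j * ∑ k ∈ Finset.range (n + 1), h a i ^ k / ((k + 1) ! : ℝ) *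
        ((l.map fun a => h a i).sum ^ (n - k) / ((n - k) ! : ℝ)) := by
  rw [expProd_cons, tmul_cons, tmul_eq_splitSum, splitSum_replicate, Finset.mul_sum]
  simp only [expProd_replicate]
  congr 1
  · simp [texp]
  · refine Finset.sum_congr rfl fun k _ => ?_
    simp [texp]
    ring

/-! ### Divided differences in the time variable -/

open Polynomial in
/-- The functional on polynomials with values `(n + 1)! c_n` at `X ^ (n + 1)`, where `c_n` is the
coordinate of the product of exponentials at the word `j 0 ⋯ 0` with `n` time letters. -/
def timeMoment {α : Type*} (τ δ : α → ℝ) : List α → ℝ[X] → ℝ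
  | [], _ => 0
  | a :: l, P => timeMoment τ δ l P + δ a *
      (if τ a = 0 then P.derivative.eval (l.map τ).sum
        else (P.eval (τ a + (l.map τ).sum) - P.eval (l.map τ).sum) / τ a)

open Polynomial in
lemma timeMoment_sub {α : Type*} (τ δ δ' : α → ℝ) (l : List α) (P : ℝ[X]) :
    timeMoment τ (fun a => δ a - δ' a) l P = timeMoment τ δ l P - timeMoment τ δ' l P := by
  induction l with
  | nil => simp [timeMoment]
  | cons a l ih => rw [timeMoment, timeMoment, timeMoment, ih]; ring

open Polynomial in
lemma timeMoment_add {α : Type*} (τ δ : α → ℝ) (l : List α) (P Q : ℝ[X]) :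
    timeMoment τ δ l (P + Q) = timeMoment τ δ l P + timeMoment τ δ l Q := by
  induction l with
  | nil => simp [timeMoment]
  | cons a l ih =>
    simp only [timeMoment, ih, Polynomial.derivative_add, Polynomial.eval_add]
    split_ifs <;> ring

open Polynomial in
lemma timeMoment_C_mul {α : Type*} (τ δ : α → ℝ) (l : List α) (c : ℝ) (P : ℝ[X]) :
    timeMoment τ δ l (C c * P) = c * timeMoment τ δ l P := by
  induction l with
  | nil => simp [timeMoment]
  | cons a l ih =>
    simp only [timeMoment, ih, Polynomial.derivative_C_mul, Polynomial.eval_mul,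
      Polynomial.eval_C]
    split_ifs <;> ring

open Polynomial in
lemma timeMoment_one {α : Type*} (τ δ : α → ℝ) (l : List α) :
    timeMoment τ δ l 1 = 0 := by
  induction l with
  | nil => simp [timeMoment]
  | cons a l ih => simp [timeMoment, ih]

/-- This is the divided difference of X ^ (n + 1) between b and a + b: the binomial expansion
without its b ^ (n + 1) term, divided by a. At a = 0 it degenerates to the derivative. -/
lemma factorial_mul_sum_pow_div (a b : ℝ) (n : ℕ) :
    ((n + 1) ! : ℝ) * ∑ k ∈ Finset.range (n + 1), a ^ k / ((k + 1) ! : ℝ) *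
        (b ^ (n - k) / ((n - k) ! : ℝ)) =
      if a = 0 then (n + 1) * b ^ n else ((a + b) ^ (n + 1) - b ^ (n + 1)) / a := by
  split_ifs with ha
  · subst ha
    rw [Finset.sum_eq_single 0 (fun k _ hk => by simp [hk]) (by simp)]
    have := Nat.factorial_ne_zero n
    rw [Nat.factorial_succ]
    push_cast
    simp
    field_simp
  · have h := sum_pow_div_factorial a b (n + 1)
    rw [Finset.sum_range_succ'] at h
    rw [eq_div_iff ha]
    have h' : a * ∑ k ∈ Finset.range (n + 1), a ^ k / ((k + 1) ! : ℝ) *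
        (b ^ (n - k) / ((n - k) ! : ℝ)) =
        (a + b) ^ (n + 1) / ((n + 1) ! : ℝ) - b ^ (n + 1) / ((n + 1) ! : ℝ) := by
      rw [← h, Finset.mul_sum]
      simp only [Nat.add_sub_add_right, pow_zero, Nat.factorial_zero, Nat.cast_one, div_one,
        one_mul, Nat.sub_zero, add_sub_cancel_right]
      refine Finset.sum_congr rfl fun k _ => ?_
      rw [pow_succ]
      ring
    have hn : ((n + 1) ! : ℝ) ≠ 0 := by exact_mod_cast Nat.factorial_ne_zero (n + 1)
    rw [mul_assoc, mul_comm _ a, h']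
    field_simp

open Polynomial in
lemma timeMoment_X_pow {α κ : Type*} (h : α → κ → ℝ) (l : List α) (i j : κ) (n : ℕ) :
    timeMoment (fun a => h a i) (fun a => h a j) l (X ^ (n + 1)) =
      ((n + 1) ! : ℝ) * expProd h l (j :: List.replicate n i) := by
  induction l with
  | nil => simp [timeMoment, expProd_nil, tone]
  | cons a l ih =>
    rw [timeMoment, ih, expProd_cons_replicate, mul_add, mul_left_comm,
      factorial_mul_sum_pow_div]
    simp

-- The functional is linear in the weights and kills constants, and its values on the other
-- monomials are signature coordinates. Equal products with equal time components thus give a zero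
-- functional for the differences.
open Polynomial in
lemma timeMoment_congr {α κ : Type*} {h h' : α → κ → ℝ} {l : List α} {i : κ}
    (hi : ∀ a, h a i = h' a i) (he : expProd h l = expProd h' l) (j : κ) (P : ℝ[X]) :
    timeMoment (fun a => h a i) (fun a => h a j - h' a j) l P = 0 := by
  induction P using Polynomial.induction_on' with
  | add P Q hP hQ => rw [timeMoment_add, hP, hQ, add_zero]
  | monomial n c =>
    rw [← Polynomial.C_mul_X_pow_eq_monomial, timeMoment_C_mul]
    cases n with
    | zero => rw [pow_zero, timeMoment_one, mul_zero]
    | succ n =>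
      have e : (fun a => h a i) = fun a => h' a i := funext hi
      rw [timeMoment_sub, timeMoment_X_pow, e, timeMoment_X_pow, he, sub_self, mul_zero]

/-! ### Test polynomials with prescribed nodes -/

open Polynomial in
/-- The product of `X - T` over all times `T` still to go along a list of durations. -/
def nodePoly {α : Type*} (τ : α → ℝ) : List α → ℝ[X]
  | [] => X
  | a :: l => (X - C (τ a + (l.map τ).sum)) * nodePoly τ l

lemma nodePoly_eval_sum {α : Type*} (τ : α → ℝ) (l : List α) :
    (nodePoly τ l).eval (l.map τ).sum = 0 := by
  cases l <;> simp [nodePoly]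

lemma nodePoly_eval_pos {α : Type*} (τ : α → ℝ) (l : List α) (hl : ∀ a ∈ l, 0 < τ a) (s : ℝ)
    (hs : (l.map τ).sum < s) : 0 < (nodePoly τ l).eval s := by
  induction l with
  | nil => simpa [nodePoly] using hs
  | cons a l ih =>
    have ha := hl a (by simp)
    simp only [List.map_cons, List.sum_cons] at hs
    have := ih (fun b hb => hl b (by simp [hb])) (by linarith)
    simp only [nodePoly, Polynomial.eval_mul, Polynomial.eval_sub, Polynomial.eval_X,
      Polynomial.eval_C]
    exact mul_pos (by linarith) this

/-- Positive durations make the nodes distinct, so the largest one is a simple root. -/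
lemma nodePoly_derivative_eval_ne_zero {α : Type*} (τ : α → ℝ) (l : List α)
    (hl : ∀ a ∈ l, 0 < τ a) :
    (nodePoly τ l).derivative.eval (l.map τ).sum ≠ 0 := by
  cases l with
  | nil => simp [nodePoly]
  | cons a l =>
    have ha := hl a (by simp)
    have := nodePoly_eval_pos τ l (fun b hb => hl b (by simp [hb]))
      (τ a + (l.map τ).sum) (by linarith)
    simpa [nodePoly] using this.ne'

-- With positive durations, each term is a difference of values at two nodes, where the polynomial
-- vanishes. The cofactor `Q` absorbs the linear factors split off in the induction.
open Polynomial in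
lemma timeMoment_mul_nodePoly {α : Type*} (τ δ : α → ℝ) (l : List α) (hl : ∀ a ∈ l, 0 < τ a)
    (Q : ℝ[X]) : timeMoment τ δ l (Q * nodePoly τ l) = 0 := by
  induction l generalizing Q with
  | nil => simp [timeMoment]
  | cons a l ih =>
    rw [timeMoment, if_neg (hl a (by simp)).ne']
    simp only [nodePoly]
    rw [← mul_assoc, ih (fun b hb => hl b (by simp [hb]))]
    simp [nodePoly_eval_sum]

/-- The system is triangular: the node polynomial of the tail kills every later term and is nonzero
at the one new node, which isolates the head weight. -/
lemma timeMoment_injective {α : Type*} (τ δ : α → ℝ) (l : List α) (hl : ∀ a ∈ l, 0 < τ a)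
    (h : ∀ P, timeMoment τ δ l P = 0) : ∀ a ∈ l, δ a = 0 := by
  induction l with
  | nil => simp
  | cons a l ih =>
    have ha := hl a (by simp)
    have hl' : ∀ b ∈ l, 0 < τ b := fun b hb => hl b (by simp [hb])
    have hδ : δ a = 0 := by
      -- The trivial cofactor matches the form required by `timeMoment_mul_nodePoly`.
      have h1 := h (1 * nodePoly τ l)
      rw [timeMoment, timeMoment_mul_nodePoly τ δ l hl', if_neg ha.ne', one_mul,
        nodePoly_eval_sum] at h1
      have := nodePoly_eval_pos τ l hl' (τ a + (l.map τ).sum) (by linarith)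
      simpa [this.ne', ha.ne'] using h1
    simp only [timeMoment, hδ, zero_mul, add_zero] at h
    intro b hb
    rcases List.mem_cons.1 hb with rfl | hb
    · exact hδ
    · exact ih hl' h b hb

/-- The initial factor has duration t₀ = 0, so its term is a derivative at the largest node of the
tail; it is detected because that root is simple. -/
lemma timeMoment_injective_of_head {α : Type*} (τ δ : α → ℝ) (a : α) (l : List α)
    (ha : τ a = 0) (hl : ∀ a ∈ l, 0 < τ a) (h : ∀ P, timeMoment τ δ (a :: l) P = 0) :
    ∀ b ∈ a :: l, δ b = 0 := by
  have hδ : δ a = 0 := by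
    have h1 := h (1 * nodePoly τ l)
    rw [timeMoment, timeMoment_mul_nodePoly τ δ l hl, if_pos ha, one_mul, zero_add] at h1
    exact (mul_eq_zero.1 h1).resolve_right (nodePoly_derivative_eval_ne_zero τ l hl)
  simp only [timeMoment, hδ, zero_mul, add_zero] at h
  intro b hb
  rcases List.mem_cons.1 hb with rfl | hb
  · exact hδ
  · exact timeMoment_injective τ δ l hl h b hb

lemma increment_injective {E : Type*} [AddGroup E] {N : ℕ} {x y : Fin (N + 1) → E}
    (h : ∀ i, increment x i = increment y i) : x = y := by
  ext i
  induction i using Fin.induction with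
  | zero => exact h 0
  | succ i ih =>
    have := h i.succ
    simp only [increment, Fin.cases_succ, ih] at this
    exact sub_left_injective this

/-- The time-augmented signature determines the path. -/
lemma sigSeries_injective {ι : Type*} {N : ℕ} {t : Fin (N + 1) → ℝ} (ht0 : t 0 = 0)
    (ht : StrictMono t) : Function.Injective (sigSeries (ι := ι) t) := by
  intro x y hxy
  rw [sigSeries_eq_expProd, sigSeries_eq_expProd] at hxy
  refine increment_injective fun i => ?_
  ext j
  -- The words used are the space letter `j` followed by time letters only.
  have h := timeMoment_congr (i := none) (by intro a; rfl) hxy (some j)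
  rw [List.finRange_succ] at h
  have h2 := timeMoment_injective_of_head _ _ _ _ (by simpa [augment, increment] using ht0) (by
    intro a ha
    obtain ⟨b, _, rfl⟩ := List.mem_map.1 ha
    simpa [augment, increment] using ht Fin.castSucc_lt_succ) h i
    (by rw [← List.finRange_succ]; exact List.mem_finRange i)
  simpa [augment, sub_eq_zero] using h2

/-! ### Dominated families in `ℓ²` -/

lemma summable_sq {κ : Type*} (g : L2 κ) : Summable fun i => g i ^ 2 := by
  simpa using (lp.memℓp g).summable (by simp)

lemma norm_sq_eq_tsum {κ : Type*} (g : L2 κ) : ‖g‖ ^ 2 = ∑' i, g i ^ 2 := by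
  simpa using lp.norm_rpow_eq_tsum (p := 2) (by simp) g

/-- A map into `ℓ²` with continuous coordinates is continuous if it is dominated by an element of
`ℓ²`. -/
lemma continuous_of_dominated {Z κ : Type*} [TopologicalSpace Z] {f : Z → L2 κ} (g : L2 κ)
    (hc : ∀ w, Continuous fun z => f z w) (hb : ∀ z w, |f z w| ≤ g w) : Continuous f := by
  refine continuous_iff_continuousAt.2 fun z₀ => ?_
  refine tendsto_iff_norm_sub_tendsto_zero.2 ?_
  have h : Tendsto (fun z => ∑' w, (f z w - f z₀ w) ^ 2) (𝓝 z₀) (𝓝 (∑' _ : κ, (0 : ℝ))) := by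
    -- Two values bounded by g w differ by at most 2 g w; hence the factor 4 after squaring.
    refine tendsto_tsum_of_dominated_convergence ((summable_sq g).mul_left 4) (fun w => ?_)
      (Eventually.of_forall fun z w => ?_)
    · have h : Continuous fun z => (f z w - f z₀ w) ^ 2 := by
        have := hc w
        fun_prop
      simpa using h.tendsto z₀
    · rw [Real.norm_eq_abs, abs_of_nonneg (sq_nonneg _)]
      have h1 := abs_le.1 (hb z w)
      have h2 := abs_le.1 (hb z₀ w)
      nlinarith
  have h' := (Real.continuous_sqrt.tendsto _).comp h
  simp only [tsum_zero, Real.sqrt_zero] at h'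
  refine h'.congr fun z => ?_
  rw [Function.comp_apply, ← Real.sqrt_sq (norm_nonneg (f z - f z₀)), norm_sq_eq_tsum]
  rfl

/-! ### Domination and continuity of signatures -/

lemma abs_texp_le {ι : Type*} {h g : ι → ℝ} (hg : ∀ i, |h i| ≤ g i) (w : List ι) :
    |texp h w| ≤ texp g w := by
  have key : |(w.map h).prod| ≤ (w.map g).prod := by
    induction w with
    | nil => simp
    | cons i w ih =>
      simp only [List.map_cons, List.prod_cons, abs_mul]
      exact mul_le_mul (hg i) ih (abs_nonneg _) ((abs_nonneg _).trans (hg i))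
  rw [texp, texp, abs_div, abs_of_nonneg (Nat.cast_nonneg (α := ℝ) _)]
  exact div_le_div_of_nonneg_right key (by positivity)

lemma abs_tmul_le {ι : Type*} {a b A B : TensorSeries ι} (ha : ∀ w, |a w| ≤ A w)
    (hb : ∀ w, |b w| ≤ B w) (w : List ι) : |tmul a b w| ≤ tmul A B w := by
  refine (Finset.abs_sum_le_sum_abs _ _).trans (Finset.sum_le_sum fun k _ => ?_)
  rw [abs_mul]
  exact mul_le_mul (ha _) (hb _) (abs_nonneg _) ((abs_nonneg _).trans (ha _))

lemma abs_expProd_le {α κ : Type*} {h g : α → κ → ℝ} (hg : ∀ a i, |h a i| ≤ g a i) (l : List α)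
    (w : List κ) : |expProd h l w| ≤ expProd g l w := by
  induction l generalizing w with
  | nil => cases w <;> simp [expProd_nil, tone]
  | cons a l ih => exact abs_tmul_le (abs_texp_le (hg a)) ih w

lemma continuous_expProd {Z α κ : Type*} [TopologicalSpace Z] {h : Z → α → κ → ℝ}
    (hc : ∀ a i, Continuous fun z => h z a i) (l : List α) (w : List κ) :
    Continuous fun z => expProd (h z) l w := by
  induction l generalizing w with
  | nil => exact continuous_const
  | cons a l ih =>
    have ht : ∀ w, Continuous fun z => texp (h z a) w := by
      intro w
      refine Continuous.div_const ?_ _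
      induction w with
      | nil => exact continuous_const
      | cons i w ihw =>
        simp only [List.map_cons, List.prod_cons]
        exact (hc a i).mul ihw
    simp only [expProd_cons, tmul]
    exact continuous_finsetSum _ fun k _ => (ht _).mul (ih _)

/-- A path dominating the signatures of all paths with coordinates bounded by `g`. -/
def dominatingPath {ι : Type*} {N : ℕ} (g : L2 ι) (i : Fin (N + 1)) : L2 ι :=
  ((i : ℝ) + 1) • (2 : ℝ) • g

/-- The factor 2 bounds a difference of two values each bounded by `g`. Starting at index i + 1
gives the initial increment the same size as the others. -/
lemma increment_dominatingPath {ι : Type*} {N : ℕ} (g : L2 ι) (i : Fin (N + 1)) :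
    increment (dominatingPath g) i = (2 : ℝ) • g := by
  cases i using Fin.cases with
  | zero => simp [increment, dominatingPath]
  | succ i =>
    simp only [increment, dominatingPath, Fin.cases_succ, Fin.val_succ, Fin.val_castSucc]
    rw [← sub_smul]
    push_cast
    simp

lemma abs_sigSeries_le {ι : Type*} {N : ℕ} {t : Fin (N + 1) → ℝ} (ht0 : t 0 = 0)
    (ht : StrictMono t) {x : Fin (N + 1) → L2 ι} {g : L2 ι} (hg : ∀ i j, |x i j| ≤ g j)
    (w : List (Option ι)) : |sigSeries t x w| ≤ sigSeries t (dominatingPath g) w := by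
  rw [sigSeries_eq_expProd, sigSeries_eq_expProd]
  refine abs_expProd_le (fun i j => ?_) _ _
  cases j with
  | none =>
    refine le_of_eq (abs_of_nonneg ?_)
    cases i using Fin.cases with
    | zero => simp [augment, increment, ht0]
    | succ i => simpa [augment, increment] using (ht Fin.castSucc_lt_succ).le
  | some j =>
    rw [increment_dominatingPath]
    cases i using Fin.cases with
    | zero =>
      have := hg 0 j
      have := abs_nonneg (x 0 j)
      simp only [augment, increment, Fin.cases_zero, lp.coeFn_smul, Pi.smul_apply, smul_eq_mul]
      linarith
    | succ i =>
      have h1 := hg i.succ j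
      have h2 := hg i.castSucc j
      simp only [augment, increment, Fin.cases_succ, lp.coeFn_smul, Pi.smul_apply, smul_eq_mul,
        lp.coeFn_sub, Pi.sub_apply]
      exact (abs_sub _ _).trans (by linarith)

lemma continuous_sigSeries {Z ι : Type*} [TopologicalSpace Z] {N : ℕ} (t : Fin (N + 1) → ℝ)
    {x : Z → Fin (N + 1) → L2 ι} (hx : ∀ i j, Continuous fun z => x z i j)
    (w : List (Option ι)) : Continuous fun z => sigSeries t (x z) w := by
  simp only [sigSeries_eq_expProd]
  refine continuous_expProd (fun i j => ?_) _ _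
  cases j with
  | none => exact continuous_const
  | some j =>
    cases i using Fin.cases with
    | zero => exact hx 0 j
    | succ i => exact (hx i.succ j).sub (hx i.castSucc j)

/-! ### Characteristic features -/

/-- A feature map into `ℓ²`, dominated and with continuous coordinates, that is injective and the
span of whose coordinates is an algebra. -/
structure IsAlgebraicFeature {C κ : Type*} [TopologicalSpace C] (F : C → L2 κ) : Prop where
  continuous_coord : ∀ w, Continuous fun x => F x w
  dominated : ∃ g : L2 κ, ∀ x w, |F x w| ≤ g w
  one : ∃ w, ∀ x, F x w = 1
  mul : ∀ u v, ∃ l : List κ, ∀ x, F x u * F x v = (l.map fun w => F x w).sum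
  injective : Function.Injective F

lemma IsAlgebraicFeature.continuous {C κ : Type*} [TopologicalSpace C] {F : C → L2 κ}
    (hF : IsAlgebraicFeature F) : Continuous F :=
  hF.dominated.elim fun g hg => continuous_of_dominated g hF.continuous_coord hg

/-- Only coordinatewise continuity, a common bound and injectivity of `x` are needed, so the same
argument serves paths in K and paths of expected signatures. -/
lemma isAlgebraicFeature_signature {Z ι : Type*} [TopologicalSpace Z] {N : ℕ}
    {t : Fin (N + 1) → ℝ} (ht0 : t 0 = 0) (ht : StrictMono t) {x : Z → Fin (N + 1) → L2 ι}
    (hc : ∀ i j, Continuous fun z => x z i j) (g : L2 ι) (hg : ∀ z i j, |x z i j| ≤ g j)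
    (hinj : Function.Injective x) : IsAlgebraicFeature fun z => signature t (x z) where
  continuous_coord := continuous_sigSeries t hc
  dominated := ⟨signature t (dominatingPath g), fun z => abs_sigSeries_le ht0 ht (hg z)⟩
  one := ⟨[], fun z => (isGroupLike_sigSeries t (x z)).1⟩
  mul u v := by
    obtain ⟨l, hl⟩ := exists_shuffleSum_eq u v
    exact ⟨l, fun z => by
      rw [← hl]; exact ((isGroupLike_sigSeries t (x z)).2 u v).symm⟩
  injective z z' h := hinj (sigSeries_injective ht0 ht (congrArg Subtype.val h))

/-! ### Density of the span of the coordinates -/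

section Algebra

variable {C κ : Type*} [TopologicalSpace C] {F : C → L2 κ}

/-- The continuous functions that are spanned by the coordinates of a feature map. -/
def IsAlgebraicFeature.subalgebra (hF : IsAlgebraicFeature F) : Subalgebra ℝ C(C, ℝ) :=
  Submodule.toSubalgebra
    (Submodule.span ℝ (Set.range fun w => (⟨fun x => F x w, hF.continuous_coord w⟩ : C(C, ℝ))))
    (by
      obtain ⟨w, hw⟩ := hF.one
      exact Submodule.subset_span ⟨w, by ext x; exact hw x⟩)
    (by
      intro a b ha hb
      refine Submodule.span_induction₂ (p := fun a b _ _ => a * b ∈ Submodule.span ℝ _)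
        ?_ ?_ ?_ ?_ ?_ ?_ ?_ ha hb
      · rintro _ _ ⟨u, rfl⟩ ⟨v, rfl⟩
        obtain ⟨l, hl⟩ := hF.mul u v
        have : (⟨fun x => F x u, hF.continuous_coord u⟩ : C(C, ℝ)) *
            ⟨fun x => F x v, hF.continuous_coord v⟩ =
            (l.map fun w => (⟨fun x => F x w, hF.continuous_coord w⟩ : C(C, ℝ))).sum := by
          ext x
          have e : ∀ l : List κ, (l.map fun w =>
              (⟨fun x => F x w, hF.continuous_coord w⟩ : C(C, ℝ))).sum x =
              (l.map fun w => F x w).sum := by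
            intro l
            induction l with
            | nil => rfl
            | cons w l ih => simp [ih]
          rw [e]
          exact hl x
        rw [this]
        refine list_sum_mem fun f hf => ?_
        obtain ⟨w, _, rfl⟩ := List.mem_map.1 hf
        exact Submodule.subset_span ⟨w, rfl⟩
      · intro b _; simp
      · intro b _; simp
      · intro a b c _ _ _ h1 h2; rw [add_mul]; exact add_mem h1 h2
      · intro a b c _ _ _ h1 h2; rw [mul_add]; exact add_mem h1 h2
      · intro r a b _ _ h; rw [smul_mul_assoc]; exact Submodule.smul_mem _ r h
      · intro r a b _ _ h; rw [mul_smul_comm]; exact Submodule.smul_mem _ r h)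

/-- Stone–Weierstrass: an ℓ² vector is determined by its coordinates, so injectivity of `F`
separates points. -/
lemma IsAlgebraicFeature.dense_subalgebra [CompactSpace C] (hF : IsAlgebraicFeature F) :
    Dense (hF.subalgebra : Set C(C, ℝ)) := by
  have hsep : hF.subalgebra.SeparatesPoints := by
    intro x y hxy
    have : ∃ w, F x w ≠ F y w := by
      by_contra! h
      exact hxy (hF.injective (lp.ext (funext h)))
    obtain ⟨w, hw⟩ := this
    exact ⟨_, ⟨⟨fun x => F x w, hF.continuous_coord w⟩, Submodule.subset_span ⟨w, rfl⟩, rfl⟩, hw⟩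
  have := ContinuousMap.subalgebra_topologicalClosure_eq_top_of_separatesPoints _ hsep
  rw [dense_iff_closure_eq, ← Subalgebra.topologicalClosure_coe, this]
  rfl

end Algebra

/-! ### Mean embeddings of probability measures -/

section Embedding

variable {C κ : Type*} [TopologicalSpace C] [CompactSpace C] [MeasurableSpace C]
  [OpensMeasurableSpace C] {F : C → L2 κ}

/-- The mean embedding `μ ↦ ∫ F dμ`. -/
def meanEmbedding (F : C → L2 κ) (μ : ProbabilityMeasure C) : L2 κ :=
  ∫ x, F x ∂(μ : Measure C)

lemma IsAlgebraicFeature.integrable (hF : IsAlgebraicFeature F) (μ : Measure C)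
    [IsFiniteMeasure μ] : Integrable F μ :=
  hF.continuous.integrable_of_hasCompactSupport (HasCompactSupport.of_compactSpace F)

lemma IsAlgebraicFeature.meanEmbedding_apply (hF : IsAlgebraicFeature F)
    (μ : ProbabilityMeasure C) (w : κ) :
    meanEmbedding F μ w = ∫ x, F x w ∂(μ : Measure C) :=
  ((lp.evalCLM ℝ (fun _ : κ => ℝ) 2 w).integral_comp_comm (hF.integrable μ)).symm

/-- Domination survives averaging, which lets mean embeddings serve as the path values at the next
rank. -/
lemma IsAlgebraicFeature.abs_meanEmbedding_le {g : L2 κ} (hF : IsAlgebraicFeature F)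
    (hg : ∀ x w, |F x w| ≤ g w) (μ : ProbabilityMeasure C) (w : κ) :
    |meanEmbedding F μ w| ≤ g w := by
  rw [hF.meanEmbedding_apply]
  simpa using norm_integral_le_of_norm_le_const (μ := (μ : Measure C)) (f := fun x => F x w)
    (C := g w) (Eventually.of_forall fun x => hg x w)

lemma IsAlgebraicFeature.continuous_meanEmbedding_apply (hF : IsAlgebraicFeature F) (w : κ) :
    Continuous fun μ => meanEmbedding F μ w := by
  simp only [hF.meanEmbedding_apply]
  have := ProbabilityMeasure.continuous_integral_boundedContinuousFunction
    (BoundedContinuousFunction.mkOfCompact ⟨fun x => F x w, hF.continuous_coord w⟩)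
  exact this

lemma IsAlgebraicFeature.continuous_meanEmbedding (hF : IsAlgebraicFeature F) :
    Continuous (meanEmbedding F) :=
  hF.dominated.elim fun g hg =>
    continuous_of_dominated g hF.continuous_meanEmbedding_apply (hF.abs_meanEmbedding_le hg)

lemma continuous_integral_continuousMap (μ : Measure C) [IsFiniteMeasure μ] :
    Continuous fun f : C(C, ℝ) => ∫ x, f x ∂μ := by
  have h : ∀ f : C(C, ℝ), Integrable f μ := fun f =>
    f.continuous.integrable_of_hasCompactSupport (HasCompactSupport.of_compactSpace f)
  refine continuous_iff_continuousAt.2 fun f => ?_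
  refine tendsto_iff_norm_sub_tendsto_zero.2 ?_
  have hlim : Tendsto (fun g : C(C, ℝ) => ‖g - f‖ * μ.real Set.univ) (𝓝 f) (𝓝 0) := by
    have : Continuous fun g : C(C, ℝ) => ‖g - f‖ * μ.real Set.univ := by fun_prop
    simpa using this.tendsto f
  refine squeeze_zero (fun _ => norm_nonneg _) (fun g => ?_) hlim
  rw [← integral_sub (h g) (h f)]
  exact norm_integral_le_of_norm_le_const (Eventually.of_forall fun x => (g - f).norm_coe_le_norm x)

/-- Equal embeddings give equal integrals on the span of the coordinates, hence by density on all
continuous functions, and these determine a finite Borel measure. -/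
lemma IsAlgebraicFeature.injective_meanEmbedding [HasOuterApproxClosed C] [BorelSpace C]
    (hF : IsAlgebraicFeature F) : Function.Injective (meanEmbedding F) := by
  intro μ ν h
  have h1 : ∀ f : C(C, ℝ), ∫ x, f x ∂(μ : Measure C) = ∫ x, f x ∂(ν : Measure C) := by
    have hi : ∀ (ρ : ProbabilityMeasure C) (f : C(C, ℝ)), Integrable f (ρ : Measure C) :=
      fun ρ f => f.continuous.integrable_of_hasCompactSupport (HasCompactSupport.of_compactSpace f)
    refine fun f => congrFun (Continuous.ext_on hF.dense_subalgebra
      (continuous_integral_continuousMap _) (continuous_integral_continuousMap _) ?_) f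
    intro f hf
    refine Submodule.span_induction (p := fun f _ => ∫ x, f x ∂(μ : Measure C) =
      ∫ x, f x ∂(ν : Measure C)) ?_ ?_ ?_ ?_ hf
    · rintro _ ⟨w, rfl⟩
      have := congrArg (fun v : L2 κ => v w) h
      simp only [hF.meanEmbedding_apply] at this
      exact this
    · simp
    · intro f g _ _ hf hg
      simp only [ContinuousMap.add_apply]
      rw [integral_add (hi μ f) (hi μ g), integral_add (hi ν f) (hi ν g), hf, hg]
    · intro r f _ hf
      simp only [ContinuousMap.smul_apply]
      rw [integral_smul, integral_smul, hf]
  have : (μ : Measure C) = ν :=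
    ext_of_forall_integral_eq_of_IsFiniteMeasure fun f => h1 f.toContinuousMap
  exact Subtype.ext this

/-- On a compact space, the mean embedding of an algebraic feature map is a topological embedding
of the space of probability measures with the weak topology. -/
lemma IsAlgebraicFeature.isEmbedding_meanEmbedding [T2Space C] [HasOuterApproxClosed C]
    [BorelSpace C] (hF : IsAlgebraicFeature F) : IsEmbedding (meanEmbedding F) :=
  -- A continuous injection from the compact space of probability measures into a Hausdorff space is
  -- a closed embedding.
  (hF.continuous_meanEmbedding.isClosedEmbedding hF.injective_meanEmbedding).isEmbedding

end Embedding

/-! ### Measurability and embeddings of spaces of probability measures -/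

/-- The evaluation `σ`-algebra on probability measures is the Borel `σ`-algebra of the weak
topology. -/
instance instBorelSpaceProbabilityMeasure (E : Type*) [TopologicalSpace E]
    [TopologicalSpace.PseudoMetrizableSpace E]
    [SecondCountableTopology E] [MeasurableSpace E] [BorelSpace E] :
    BorelSpace (ProbabilityMeasure E) where
  measurable_eq := by
    refine le_antisymm ?_ OpensMeasurableSpace.borel_le
    have h : Measurable[borel (ProbabilityMeasure E)]
        (fun μ : ProbabilityMeasure E => (μ : Measure E)) := by
      let _ : MeasurableSpace (ProbabilityMeasure E) := borel _
      have : BorelSpace (ProbabilityMeasure E) := ⟨rfl⟩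
      refine Measurable.measure_of_isPiSystem_of_isProbabilityMeasure
        (S := {s : Set E | IsClosed s})
        (by rw [BorelSpace.measurable_eq (α := E), borel_eq_generateFrom_isClosed])
        isPiSystem_isClosed fun s hs => ?_
      -- The mass of a closed set is a pointwise limit of integrals of continuous functions, which
      -- are weakly continuous in the measure.
      refine measurable_of_tendsto_metrizable (f := fun n (μ : ProbabilityMeasure E) =>
        ∫⁻ x, (IsClosed.apprSeq hs n x : ℝ≥0∞) ∂(μ : Measure E)) (fun n => ?_)
        (tendsto_pi_nhds.2 fun μ =>
          HasOuterApproxClosed.tendsto_lintegral_apprSeq hs (μ : Measure E))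
      refine Continuous.measurable (continuous_iff_continuousAt.2 fun μ => ?_)
      exact (ProbabilityMeasure.tendsto_iff_forall_lintegral_tendsto.1 tendsto_id) _
    exact measurable_iff_comap_le.1 h

/-- A probability measure that charges only the range of a measurable embedding is a
push-forward. -/
lemma exists_map_eq_of_ae_mem_range {C E : Type*} [MeasurableSpace C] [MeasurableSpace E]
    {e : C → E} (he : MeasurableEmbedding e) (μ : ProbabilityMeasure E)
    (h : ∀ᵐ x ∂(μ : Measure E), x ∈ Set.range e) :
    ∃ ν : ProbabilityMeasure C, ν.map he.measurable.aemeasurable = μ := by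
  have hmap : (Measure.comap e (μ : Measure E)).map e = μ := by
    rw [he.map_comap, Measure.restrict_eq_self_of_ae_mem h]
  have hp : IsProbabilityMeasure (Measure.comap e (μ : Measure E)) := by
    refine ⟨?_⟩
    have := congrArg (fun m : Measure E => m Set.univ) hmap
    simpa [he.map_apply] using this
  exact ⟨⟨_, hp⟩, Subtype.ext hmap⟩

/-- The push-forward along an embedding of a compact space embeds the spaces of probability
measures. -/
lemma isClosedEmbedding_map {C E : Type*} [TopologicalSpace C] [CompactSpace C] [T2Space C]
    [MeasurableSpace C] [BorelSpace C] [TopologicalSpace E] [MeasurableSpace E] [BorelSpace E]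
    [HasOuterApproxClosed E] {e : C → E} (hc : Continuous e) (he : MeasurableEmbedding e) :
    IsClosedEmbedding fun ν : ProbabilityMeasure C => ν.map he.measurable.aemeasurable := by
  refine (ProbabilityMeasure.continuous_map hc).isClosedEmbedding fun μ ν h => ?_
  have h1 : (μ : Measure C).map e = (ν : Measure C).map e := congrArg Subtype.val h
  have h2 := congrArg (Measure.comap e) h1
  rw [he.comap_map, he.comap_map] at h2
  exact Subtype.ext h2

/-! ### Metrization by embeddings -/

/-- If laws and feature vectors factor through embeddings of one space, then distances of feature
vectors metrize the topology of convergence of the laws. -/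
lemma metrizes_of_isEmbedding {α P Y V : Type*} [TopologicalSpace P] [TopologicalSpace Y]
    [NormedAddCommGroup V] {J : P → Y} {Φ : P → V} (hJ : IsEmbedding J) (hΦ : IsEmbedding Φ)
    (law : α → Y) (v : α → V) (h : ∀ a, ∃ p, J p = law a ∧ Φ p = v a) :
    Metrizes (fun a b => ‖v a - v b‖) (TopologicalSpace.induced law inferInstance) ∧
      (∀ a b, ‖v a - v b‖ = 0 ↔ law a = law b) ∧
      ∀ (a : ℕ → α) (b : α), Tendsto (fun n => law (a n)) atTop (𝓝 (law b)) ↔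
        Tendsto (fun n => ‖v (a n) - v b‖) atTop (𝓝 0) := by
  choose p hp hv using h
  obtain rfl : J ∘ p = law := funext hp
  obtain rfl : Φ ∘ p = v := funext hv
  refine ⟨⟨fun a => by simp, fun a b => norm_sub_rev _ _,
    fun a b c => norm_sub_le_norm_sub_add_norm_sub _ _ _, fun s => ?_⟩, fun a b => ?_, fun a b => ?_⟩
  · have hτ : TopologicalSpace.induced (J ∘ p) inferInstance =
        TopologicalSpace.induced (Φ ∘ p) inferInstance := by
      rw [← induced_compose, ← induced_compose, ← hJ.eq_induced, ← hΦ.eq_induced]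
    rw [hτ]
    let _ : PseudoMetricSpace α := PseudoMetricSpace.induced (Φ ∘ p) inferInstance
    refine (Metric.isOpen_iff (α := α)).trans ?_
    refine forall₂_congr fun a _ => exists_congr fun ε => and_congr_right fun _ => ?_
    refine forall_congr' fun b => ?_
    rw [Metric.mem_ball, dist_comm]
    exact imp_congr_left (by rw [← dist_eq_norm]; rfl)
  · rw [norm_sub_eq_zero_iff]
    exact hΦ.injective.eq_iff.trans hJ.injective.eq_iff.symm
  · rw [← tendsto_iff_norm_sub_tendsto_zero]
    exact (hJ.tendsto_nhds_iff (f := fun n => p (a n))).symm.trans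
      (hΦ.tendsto_nhds_iff (f := fun n => p (a n)))

/-! ### Paths and paths of measures over a compact set -/

section Compact

variable {N d : ℕ} {K : Set (State d)}

/-- The paths with values in `K`. -/
abbrev PathsIn (N d : ℕ) (K : Set (State d)) : Type :=
  {x : PathSpace N d // x ∈ Set.univ.pi fun _ => K}

lemma compactSpace_pathsIn (hK : IsCompact K) : CompactSpace (PathsIn N d K) :=
  isCompact_iff_compactSpace.1 (isCompact_univ_pi fun _ => hK)

lemma measurableSet_pathsIn (hK : IsCompact K) :
    MeasurableSet (Set.univ.pi fun _ => K : Set (PathSpace N d)) :=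
  (isCompact_univ_pi fun _ => hK).isClosed.measurableSet

lemma measurableEmbedding_pathsIn (hK : IsCompact K) :
    MeasurableEmbedding (Subtype.val : PathsIn N d K → PathSpace N d) :=
  MeasurableEmbedding.subtype_coe (measurableSet_pathsIn hK)

lemma toL2_apply (x : State d) (j : Fin d) : toL2 x j = x j := rfl

/-- The signature of rank one on the paths in `K`. -/
def S1In (t : Fin (N + 1) → ℝ) (K : Set (State d)) (x : PathsIn N d K) : H1 d := S1 t x.1

lemma isAlgebraicFeature_S1In {t : Fin (N + 1) → ℝ} (ht0 : t 0 = 0) (ht : StrictMono t)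
    (hK : IsCompact K) : IsAlgebraicFeature (S1In t K) := by
  obtain ⟨R, hR⟩ := hK.isBounded.exists_norm_le
  have hc : ∀ i j, Continuous fun x : PathsIn N d K => toL2 (x.1 i) j := fun i j => by
    have : Continuous fun x : PathSpace N d => x i j := by fun_prop
    exact this.comp continuous_subtype_val
  have hb : ∀ (x : PathsIn N d K) i j, |toL2 (x.1 i) j| ≤ toL2 (WithLp.toLp 2 fun _ => R) j := by
    intro x i j
    simp only [toL2_apply]
    exact (PiLp.norm_apply_le (x.1 i) j).trans (hR _ (x.2 i trivial))
  refine isAlgebraicFeature_signature ht0 ht hc _ hb fun x y h => ?_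
  refine Subtype.ext (funext fun i => PiLp.ext fun j => ?_)
  have := congrArg (fun v : L2 (Fin d) => v j) (congrFun h i)
  simpa only [toL2_apply] using this

/-- The push-forward of measures on paths in `K` to path space. -/
def extend (hK : IsCompact K) (μ : ProbabilityMeasure (PathsIn N d K)) :
    ProbabilityMeasure (PathSpace N d) :=
  μ.map (measurableEmbedding_pathsIn hK).measurable.aemeasurable

lemma isClosedEmbedding_extend (hK : IsCompact K) :
    IsClosedEmbedding (extend (N := N) hK) :=
  have := compactSpace_pathsIn (N := N) hK
  isClosedEmbedding_map continuous_subtype_val (measurableEmbedding_pathsIn hK)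

/-- The push-forward of paths of measures. -/
def extendPath (hK : IsCompact K) (μ : Fin (N + 1) → ProbabilityMeasure (PathsIn N d K)) :
    Fin (N + 1) → ProbabilityMeasure (PathSpace N d) :=
  fun i => extend hK (μ i)

lemma isClosedEmbedding_extendPath (hK : IsCompact K) :
    IsClosedEmbedding (extendPath (N := N) hK) := by
  have := compactSpace_pathsIn (N := N) hK
  have hc : Continuous (extendPath (N := N) hK) :=
    continuous_pi fun i => (isClosedEmbedding_extend hK).continuous.comp (continuous_apply i)
  exact hc.isClosedEmbedding fun μ ν h =>
    funext fun i => (isClosedEmbedding_extend hK).injective (congrFun h i)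

/-- The signature of rank two on paths of measures on the paths in `K`. -/
def S2In (t : Fin (N + 1) → ℝ) (hK : IsCompact K)
    (μ : Fin (N + 1) → ProbabilityMeasure (PathsIn N d K)) : H2 d :=
  S2 t (extendPath hK μ)

lemma integral_extend (t : Fin (N + 1) → ℝ) (hK : IsCompact K)
    (μ : ProbabilityMeasure (PathsIn N d K)) :
    ∫ x, S1 t x ∂(extend hK μ : Measure (PathSpace N d)) = meanEmbedding (S1In t K) μ :=
  (measurableEmbedding_pathsIn hK).integral_map _

/-- S² is the signature of the path of rank one mean embeddings; these inherit the dominating vector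
`g`, are weakly continuous in each coordinate, and determine the measures. -/
lemma isAlgebraicFeature_S2In {t : Fin (N + 1) → ℝ} (ht0 : t 0 = 0) (ht : StrictMono t)
    (hK : IsCompact K) : IsAlgebraicFeature (S2In t hK) := by
  have := compactSpace_pathsIn (N := N) hK
  have hF := isAlgebraicFeature_S1In (N := N) ht0 ht hK
  obtain ⟨g, hg⟩ := hF.dominated
  have he : S2In t hK = fun μ => signature t fun i => meanEmbedding (S1In t K) (μ i) := by
    ext1 μ
    simp only [S2In, S2, extendPath, integral_extend]
  rw [he]
  refine isAlgebraicFeature_signature ht0 ht (fun i j => ?_) g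
    (fun μ i j => hF.abs_meanEmbedding_le hg (μ i) j) fun μ ν h => ?_
  · exact (hF.continuous_meanEmbedding_apply j).comp (continuous_apply i)
  · exact funext fun i => hF.injective_meanEmbedding (congrFun h i)

/-- The law of a random element of an embedded compact space comes from a law on that space, and
expected features are mean embeddings. -/
lemma exists_map_eq_and_meanEmbedding_eq {Ω C E κ : Type*} {mΩ : MeasurableSpace Ω}
    [TopologicalSpace C] [CompactSpace C] [MeasurableSpace C] [OpensMeasurableSpace C]
    [MeasurableSpace E]
    {e : C → E} (he : MeasurableEmbedding e) {G : E → L2 κ}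
    (hG : IsAlgebraicFeature fun c => G (e c)) (P : Measure Ω) {Z : Ω → E} (hZ : Measurable Z)
    (hP : IsProbabilityMeasure (P.map Z)) (hmem : ∀ᵐ ω ∂P, Z ω ∈ Set.range e) :
    ∃ ν : ProbabilityMeasure C, ν.map he.measurable.aemeasurable = ⟨P.map Z, hP⟩ ∧
      meanEmbedding (fun c => G (e c)) ν = ∫ ω, G (Z ω) ∂P := by
  obtain ⟨ν, hν⟩ := exists_map_eq_of_ae_mem_range he ⟨P.map Z, hP⟩
    ((ae_map_iff hZ.aemeasurable he.measurableSet_range).2 hmem)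
  have hν' : (ν : Measure C).map e = P.map Z := congrArg Subtype.val hν
  refine ⟨ν, hν, ?_⟩
  rw [← integral_map (f := G) hZ.aemeasurable, ← hν', he.integral_map]
  · rfl
  -- `G` is controlled only on the range of `e`, which carries the law, so its measurability is
  -- checked on `C`.
  · rw [← hν', he.aestronglyMeasurable_map_iff]
    exact (hG.integrable (ν : Measure C)).aestronglyMeasurable

/-- Trajectories always stay in K, so the conditional probability of this event is almost surely 1.
The exceptional null sets are finitely many, one per time. -/
lemma ae_prediction_mem_range (hK : IsCompact K) (𝕏 : FilteredProcess.{u} N d K) :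
    ∀ᵐ ω ∂𝕏.P, 𝕏.prediction ω ∈ Set.range (extendPath (N := N) hK) := by
  have h : ∀ i, ∀ᵐ ω ∂𝕏.P, 𝕏.prediction ω i ∈ Set.range (extend (N := N) hK) := by
    intro i
    have hA := measurableSet_pathsIn (N := N) hK
    have h1 := 𝕏.prediction_ae_eq i hA
    have h2 : 𝕏.path ⁻¹' (Set.univ.pi fun _ => K) = Set.univ :=
      Set.eq_univ_of_forall fun ω j _ => 𝕏.mem j ω
    rw [h2, Set.indicator_univ, condExp_const (𝕏.filtration.le i)] at h1
    filter_upwards [h1] with ω hω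
    refine exists_map_eq_of_ae_mem_range (measurableEmbedding_pathsIn hK) _ ?_
    rw [Subtype.range_coe]
    refine (prob_compl_eq_zero_iff hA).2 ?_
    rw [Measure.real, ENNReal.toReal_eq_one_iff] at hω
    exact hω
  filter_upwards [ae_all_iff.2 h] with ω hω
  choose μ hμ using hω
  exact ⟨μ, funext hμ⟩

end Compact

end

end SigMMD

theorem theorem2 {N d : ℕ} (t : Fin (N + 1) → ℝ) (ht0 : t 0 = 0) (ht : StrictMono t)
    (K : Set (State d)) (hK : IsCompact K) :
    (Metrizes (D1 t) (tau0.{u} N d K) ∧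
      (∀ 𝕏 𝕐 : FilteredProcess.{u} N d K, D1 t 𝕏 𝕐 = 0 ↔ 𝕏.law0 = 𝕐.law0) ∧
      ∀ (𝕏 : ℕ → FilteredProcess.{u} N d K) (𝕐 : FilteredProcess.{u} N d K),
        Tendsto (fun n => (𝕏 n).law0) atTop (𝓝 𝕐.law0) ↔
          Tendsto (fun n => D1 t (𝕏 n) 𝕐) atTop (𝓝 0)) ∧
    (Metrizes (D2 t) (tau1.{u} N d K) ∧
      (∀ 𝕏 𝕐 : FilteredProcess.{u} N d K, D2 t 𝕏 𝕐 = 0 ↔ 𝕏.law1 = 𝕐.law1) ∧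
      ∀ (𝕏 : ℕ → FilteredProcess.{u} N d K) (𝕐 : FilteredProcess.{u} N d K),
        Tendsto (fun n => (𝕏 n).law1) atTop (𝓝 𝕐.law1) ↔
          Tendsto (fun n => D2 t (𝕏 n) 𝕐) atTop (𝓝 0)) := by
  have := compactSpace_pathsIn (N := N) hK
  constructor
  · refine metrizes_of_isEmbedding
      (isClosedEmbedding_map continuous_subtype_val
        (measurableEmbedding_pathsIn (N := N) hK)).isEmbedding
      (isAlgebraicFeature_S1In ht0 ht hK).isEmbedding_meanEmbedding FilteredProcess.law0
      (fun 𝕏 => ∫ ω, S1 t (𝕏.path ω) ∂𝕏.P) fun 𝕏 => ?_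
    exact exists_map_eq_and_meanEmbedding_eq (measurableEmbedding_pathsIn hK)
      (isAlgebraicFeature_S1In ht0 ht hK) 𝕏.P 𝕏.measurable_path _
      (Eventually.of_forall fun ω => by
        rw [Subtype.range_coe]
        exact fun i _ => 𝕏.mem i ω)
  · have : OpensMeasurableSpace (Fin (N + 1) → ProbabilityMeasure (PathsIn N d K)) :=
      inferInstance
    -- The evaluation σ-algebras are Borel for the weak topology, so a closed embedding is
    -- measurable with measurable images.
    have he := (isClosedEmbedding_extendPath (N := N) hK).measurableEmbedding
    refine metrizes_of_isEmbedding
      (isClosedEmbedding_map (isClosedEmbedding_extendPath hK).continuous he).isEmbedding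
      (isAlgebraicFeature_S2In ht0 ht hK).isEmbedding_meanEmbedding FilteredProcess.law1
      (fun 𝕏 => ∫ ω, S2 t (𝕏.prediction ω) ∂𝕏.P) fun 𝕏 => ?_
    exact exists_map_eq_and_meanEmbedding_eq he (isAlgebraicFeature_S2In ht0 ht hK) 𝕏.P
      𝕏.measurable_prediction _ (ae_prediction_mem_range hK 𝕏)
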